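/- Let $\overline M$ be a smooth manifold of dimension $4n$ with a smooth almost hypercomplex structure $H=(J_1,J_2,J_3)$, i.e. $J_\alpha^2=-I$ and $J_\alpha=J_\beta J_\gamma=-J_\gamma J_\beta$ for all cyclic permutations $(\alpha,\beta,\gamma)$ of $(1,2,3)$, and a smooth pseudo-Riemannian metric $g$ with $g(J_1X,J_1Y)=-g(J_2X,J_2Y)=-g(J_3X,J_3Y)=g(X,Y)$. Let $\overline\nabla$ be the Levi-Civita connection of $g$, put $\overline F_\alpha(X,Y,Z)=g((\overline\nabla_XJ_\alpha)Y,Z)$, let $\overline\theta_\alpha(Z)=g^{ij}\overline F_\alpha(e_i,e_j,Z)$ be the Lee forms (for any basis $(e_i)$ of the tangent space, $(g^{ij})$ being the inverse of the matrix $(g(e_i,e_j))$), and let $p_\alpha$ be the dual vectors, $\overline\theta_\alpha(Z)=g(Z,p_\alpha)$. Assume that $\overline M$ is a $\mathcal W$-manifold: the Nijenhuis tensors of $J_1,J_2,J_3$ vanish, $$\overline F_1(X,Y,Z)=\tfrac{1}{2(2n-1)}\left[g(X,Y)\overline\theta_1(Z)-g(X,Z)\overline\theta_1(Y)-g(X,J_1Y)\overline\theta_1(J_1Z)+g(X,J_1Z)\overline\theta_1(J_1Y)\right],$$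 and for $\alpha=2,3$ $$\overline F_\alpha(X,Y,Z)=\tfrac{1}{4n}\left[g(X,Y)\overline\theta_\alpha(Z)+g(X,Z)\overline\theta_\alpha(Y)+g(X,J_\alpha Y)\overline\theta_\alpha(J_\alpha Z)+g(X,J_\alpha Z)\overline\theta_\alpha(J_\alpha Y)\right].$$ Let $M$ be a holomorphic submanifold of $\overline M$ of dimension $4m$, $m<n$: an (immersed) submanifold such that $J_\alpha(T_pM)=T_pM$ for all $p\in M$ and $\alpha=1,2,3$, and such that the restriction of $g$ to $TM$ is non-degenerate. Denote the restrictions of $g$ and $J_\alpha$ to $M$ by the same letters, let $\nabla$ be the Levi-Civita connection of $M$, and let $h$, $A_N$ and $D$ be the second fundamental form, the shape operators and the normal connection, given by $\overline\nabla_XY=\nabla_XY+h(X,Y)$ and $\overline\nabla_XN=-A_NX+D_XN$ for tangent fields $X,Y$ and normal fields $N$. Let $p_\alpha=p_\alpha^\top+p_\alpha^\bot$ be the decomposition into tangential and normal parts along $M$. Then for all tangent vector fields $X,Y$ on $M$ and all normal vector fields $N$: $$h(X,Y)=\tfrac{1}{2(2n-1)}\,g(X,Y)\,J_1(p_1^\bot)=\tfrac{1}{4n}\,g(X,Y)\,J_\alpha(p_\alpha^\bot),\qquad\alpha=2,3;$$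 $$(\nabla_XJ_1)Y=\tfrac{1}{2(2n-1)}\left[g(X,Y)p_1^\top-\overline\theta_1(Y)X+g(X,J_1Y)J_1(p_1^\top)-\overline\theta_1(J_1Y)J_1X\right];$$ $$(\nabla_XJ_\alpha)Y=\tfrac{1}{4n}\left[g(X,Y)p_\alpha^\top+\overline\theta_\alpha(Y)X+g(X,J_\alpha Y)J_\alpha(p_\alpha^\top)+\overline\theta_\alpha(J_\alpha Y)J_\alpha X\right],\qquad\alpha=2,3;$$ $$A_{J_1N}X=J_1(A_NX)+\tfrac{1}{2(2n-1)}\left[\overline\theta_1(N)X+\overline\theta_1(J_1N)J_1X\right];$$ $$A_{J_\alpha N}X=J_\alpha(A_NX)-\tfrac{1}{4n}\left[\overline\theta_\alpha(N)X+\overline\theta_\alpha(J_\alpha N)J_\alpha X\right],\qquad\alpha=2,3;$$ $$D_X(J_\alpha N)=J_\alpha(D_XN),\qquad\alpha=1,2,3.$$ -/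

import Mathlib

open scoped Manifold ContDiff
open Bundle Module VectorField
noncomputable section

/-- A smooth pseudo-Riemannian metric on a manifold. -/
structure PseudoRiemannianMetric (E : Type*) [NormedAddCommGroup E] [NormedSpace ℝ E]
    (M : Type*) [TopologicalSpace M] [ChartedSpace E M] [IsManifold 𝓘(ℝ, E) ∞ M] where
  val : ∀ x : M, TangentSpace 𝓘(ℝ, E) x →L[ℝ] TangentSpace 𝓘(ℝ, E) x →L[ℝ] ℝ
  symm : ∀ (x : M) (u v : TangentSpace 𝓘(ℝ, E) x), val x u v = val x v u
  nondegenerate : ∀ (x : M) (u : TangentSpace 𝓘(ℝ, E) x), (∀ v, val x u v = 0) → u = 0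
  contMDiff : ContMDiff 𝓘(ℝ, E) (𝓘(ℝ, E).prod 𝓘(ℝ, E →L[ℝ] E →L[ℝ] ℝ)) ∞
    (fun x : M ↦ TotalSpace.mk' (E →L[ℝ] E →L[ℝ] ℝ)
      (E := fun x : M ↦ TangentSpace 𝓘(ℝ, E) x →L[ℝ] TangentSpace 𝓘(ℝ, E) x →L[ℝ] ℝ) x (val x))

set_option linter.unusedSectionVars false
set_option linter.unusedSimpArgs false

section
variable {E : Type*} [NormedAddCommGroup E] [NormedSpace ℝ E] [FiniteDimensional ℝ E]
  {M : Type*} [TopologicalSpace M] [ChartedSpace E M] [IsManifold 𝓘(ℝ, E) ∞ M]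

instance (x : M) : FiniteDimensional ℝ (TangentSpace 𝓘(ℝ, E) x) :=
  inferInstanceAs (FiniteDimensional ℝ E)
instance (x : M) : T2Space (TangentSpace 𝓘(ℝ, E) x) :=
  inferInstanceAs (T2Space E)

namespace PseudoRiemannianMetric
variable (g : PseudoRiemannianMetric E M)

/-- The isomorphism between tangent vectors and covectors given by the metric. -/
def flat (x : M) : TangentSpace 𝓘(ℝ, E) x ≃ₗ[ℝ] (TangentSpace 𝓘(ℝ, E) x →L[ℝ] ℝ) :=
  LinearEquiv.ofBijective (g.val x).toLinearMap (by
    have hinj : Function.Injective (g.val x).toLinearMap := by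
      rw [← LinearMap.ker_eq_bot, LinearMap.ker_eq_bot']
      intro u hu
      exact g.nondegenerate x u fun v ↦ DFunLike.congr_fun hu v
    refine ⟨hinj, (LinearMap.injective_iff_surjective_of_finrank_eq_finrank ?_).1 hinj⟩
    rw [← (LinearMap.toContinuousLinearMap (𝕜 := ℝ) (E := TangentSpace 𝓘(ℝ, E) x)
      (F' := ℝ)).finrank_eq]
    exact Subspace.dual_finrank_eq.symm)

/-- The vector dual to a covector. -/
def sharp (x : M) : (TangentSpace 𝓘(ℝ, E) x →L[ℝ] ℝ) →ₗ[ℝ] TangentSpace 𝓘(ℝ, E) x :=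
  (g.flat x).symm.toLinearMap

theorem val_sharp (x : M) (η : TangentSpace 𝓘(ℝ, E) x →L[ℝ] ℝ) (v : TangentSpace 𝓘(ℝ, E) x) :
    g.val x (g.sharp x η) v = η v :=
  DFunLike.congr_fun ((g.flat x).apply_symm_apply η) v

theorem mdifferentiableAt_val {X Y : ∀ x : M, TangentSpace 𝓘(ℝ, E) x} {x : M}
    (hX : MDiffAt (T% X) x) (hY : MDiffAt (T% Y) x) :
    MDiffAt (fun y ↦ g.val y (X y) (Y y)) x := by
  have hg := (g.contMDiff x).mdifferentiableAt (by simp)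
  have := MDifferentiableAt.clm_bundle_apply₂ (F₁ := E) (F₂ := E) (F₃ := ℝ) (E₃ := fun _ : M ↦ ℝ)
    (b := id) hg hX hY
  exact (mdifferentiableAt_totalSpace _ _).1 this |>.2

theorem ext_val {x : M} {u v : TangentSpace 𝓘(ℝ, E) x} (h : ∀ w, g.val x u w = g.val x v w) :
    u = v := by
  rw [← sub_eq_zero]
  exact g.nondegenerate x _ fun w ↦ by simp [h w]

/-- The expression on the right-hand side of Koszul's formula for `g (∇_X Y) Z`. -/
def koszul (X Y Z : ∀ x : M, TangentSpace 𝓘(ℝ, E) x) (x : M) : ℝ :=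
  (1 / 2) * (d% (fun y ↦ g.val y (Y y) (Z y)) x (X x) + d% (fun y ↦ g.val y (X y) (Z y)) x (Y x)
    - d% (fun y ↦ g.val y (X y) (Y y)) x (Z x)
    + g.val x (mlieBracket 𝓘(ℝ, E) X Y x) (Z x) - g.val x (mlieBracket 𝓘(ℝ, E) X Z x) (Y x)
    - g.val x (mlieBracket 𝓘(ℝ, E) Y Z x) (X x))

theorem tensorialAt_koszul_left (Y Z : ∀ x : M, TangentSpace 𝓘(ℝ, E) x) (x : M)
    (hY : MDiffAt (T% Y) x) (hZ : MDiffAt (T% Z) x) :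
    TensorialAt 𝓘(ℝ, E) E (fun X ↦ g.koszul X Y Z x) x where
  smul {f X} hf hX := by
    simp only [koszul, Pi.smul_apply', map_smul, _root_.smul_apply, smul_eq_mul]
    rw [mvfderiv_fun_mul hf (g.mdifferentiableAt_val hX hZ),
      mvfderiv_fun_mul hf (g.mdifferentiableAt_val hX hY), mlieBracket_smul_left hf hX,
      mlieBracket_smul_left hf hX]
    simp [g.symm x (Y x) (Z x), g.symm x (X x)]
    ring
  add {X X'} hX hX' := by
    simp only [koszul, Pi.add_apply, map_add, _root_.add_apply]
    rw [mvfderiv_fun_add (g.mdifferentiableAt_val hX hZ) (g.mdifferentiableAt_val hX' hZ),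
      mvfderiv_fun_add (g.mdifferentiableAt_val hX hY) (g.mdifferentiableAt_val hX' hY),
      mlieBracket_add_left hX hX', mlieBracket_add_left hX hX']
    simp
    ring

theorem tensorialAt_koszul_right (X Y : ∀ x : M, TangentSpace 𝓘(ℝ, E) x) (x : M)
    (hX : MDiffAt (T% X) x) (hY : MDiffAt (T% Y) x) :
    TensorialAt 𝓘(ℝ, E) E (fun Z ↦ g.koszul X Y Z x) x where
  smul {f Z} hf hZ := by
    simp only [koszul, Pi.smul_apply', map_smul, _root_.smul_apply, smul_eq_mul]
    rw [mvfderiv_fun_mul hf (g.mdifferentiableAt_val hY hZ),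
      mvfderiv_fun_mul hf (g.mdifferentiableAt_val hX hZ), mlieBracket_smul_right hf hZ,
      mlieBracket_smul_right hf hZ]
    simp [g.symm x (Z x)]
    ring
  add {Z Z'} hZ hZ' := by
    simp only [koszul, Pi.add_apply, map_add, _root_.add_apply]
    rw [mvfderiv_fun_add (g.mdifferentiableAt_val hY hZ) (g.mdifferentiableAt_val hY hZ'),
      mvfderiv_fun_add (g.mdifferentiableAt_val hX hZ) (g.mdifferentiableAt_val hX hZ'),
      mlieBracket_add_right hZ hZ', mlieBracket_add_right hZ hZ']
    simp
    ring

open Classical in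
/-- `(X, Z) ↦ g (∇_X Y) Z` at the point `x`. -/
def koszulHom (Y : ∀ x : M, TangentSpace 𝓘(ℝ, E) x) (x : M) :
    TangentSpace 𝓘(ℝ, E) x →L[ℝ] TangentSpace 𝓘(ℝ, E) x →L[ℝ] ℝ :=
  if hY : MDiffAt (T% Y) x then
    TensorialAt.mkHom₂ (fun X Z ↦ g.koszul X Y Z x) x
      (fun Z hZ ↦ g.tensorialAt_koszul_left Y Z x hY hZ)
      (fun X hX ↦ g.tensorialAt_koszul_right X Y x hX hY)
  else 0

theorem koszulHom_apply {X Y Z : ∀ x : M, TangentSpace 𝓘(ℝ, E) x} {x : M}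
    (hX : MDiffAt (T% X) x) (hY : MDiffAt (T% Y) x) (hZ : MDiffAt (T% Z) x) :
    g.koszulHom Y x (X x) (Z x) = g.koszul X Y Z x := by
  rw [koszulHom, dif_pos hY]
  exact TensorialAt.mkHom₂_apply _ _ hX hZ

/-- The Levi-Civita connection as a function on vector fields -/
def leviCivitaFun (Y : ∀ x : M, TangentSpace 𝓘(ℝ, E) x) (x : M) :
    TangentSpace 𝓘(ℝ, E) x →L[ℝ] TangentSpace 𝓘(ℝ, E) x :=
  LinearMap.toContinuousLinearMap (g.sharp x) ∘L g.koszulHom Y x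

theorem val_leviCivitaFun {X Y Z : ∀ x : M, TangentSpace 𝓘(ℝ, E) x} {x : M}
    (hX : MDiffAt (T% X) x) (hY : MDiffAt (T% Y) x) (hZ : MDiffAt (T% Z) x) :
    g.val x (g.leviCivitaFun Y x (X x)) (Z x) = g.koszul X Y Z x := by
  rw [← g.koszulHom_apply hX hY hZ]
  exact g.val_sharp x _ _

/-- A connection on the tangent bundle is the Levi-Civita connection of `g`: it is torsion-free and
`g` is parallel. -/
structure IsLeviCivita
    (cov : CovariantDerivative 𝓘(ℝ, E) E (TangentSpace 𝓘(ℝ, E) : M → Type _)) : Prop where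
  torsion_free : ∀ {X Y : ∀ x : M, TangentSpace 𝓘(ℝ, E) x} {x : M},
    MDiffAt (T% X) x → MDiffAt (T% Y) x →
    cov Y x (X x) - cov X x (Y x) = mlieBracket 𝓘(ℝ, E) X Y x
  metric : ∀ {Y Z : ∀ x : M, TangentSpace 𝓘(ℝ, E) x} {x : M} (u : TangentSpace 𝓘(ℝ, E) x),
    MDiffAt (T% Y) x → MDiffAt (T% Z) x →
    d% (fun y ↦ g.val y (Y y) (Z y)) x u = g.val x (cov Y x u) (Z x) + g.val x (Y x) (cov Z x u)

theorem leviCivitaFun_ext {Y : ∀ x : M, TangentSpace 𝓘(ℝ, E) x} {x : M}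
    {A : TangentSpace 𝓘(ℝ, E) x →L[ℝ] TangentSpace 𝓘(ℝ, E) x} (hY : MDiffAt (T% Y) x)
    (h : ∀ X Z : ∀ x : M, TangentSpace 𝓘(ℝ, E) x, MDiffAt (T% X) x → MDiffAt (T% Z) x →
      g.koszul X Y Z x = g.val x (A (X x)) (Z x)) : g.leviCivitaFun Y x = A := by
  ext u
  refine g.ext_val fun w ↦ ?_
  have hu := FiberBundle.mdifferentiableAt_extend 𝓘(ℝ, E) E u
  have hw := FiberBundle.mdifferentiableAt_extend 𝓘(ℝ, E) E w
  have := g.val_leviCivitaFun hu hY hw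
  rw [h _ _ hu hw] at this
  simpa using this

/-- The Levi-Civita connection of a pseudo-Riemannian metric. -/
def leviCivita : CovariantDerivative 𝓘(ℝ, E) E (TangentSpace 𝓘(ℝ, E) : M → Type _) where
  toFun := g.leviCivitaFun
  isCovariantDerivativeOnUniv := {
    add := by
      intro Y Y' x hY hY' _
      refine g.leviCivitaFun_ext (mdifferentiableAt_add_section hY hY') fun X Z hX hZ ↦ ?_
      simp only [_root_.add_apply, map_add, g.val_leviCivitaFun hX hY hZ,
        g.val_leviCivitaFun hX hY' hZ]
      simp only [koszul, Pi.add_apply, map_add, _root_.add_apply]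
      rw [mvfderiv_fun_add (g.mdifferentiableAt_val hY hZ) (g.mdifferentiableAt_val hY' hZ),
        mvfderiv_fun_add (g.mdifferentiableAt_val hX hY) (g.mdifferentiableAt_val hX hY'),
        mlieBracket_add_left hY hY', mlieBracket_add_right hY hY']
      simp
      ring
    leibniz := by
      intro Y f x hY hf _
      refine g.leviCivitaFun_ext (hf.smul_section hY) fun X Z hX hZ ↦ ?_
      simp only [_root_.add_apply, map_add, _root_.smul_apply, map_smul,
        g.val_leviCivitaFun hX hY hZ]
      simp only [koszul, Pi.smul_apply', map_smul, _root_.smul_apply, smul_eq_mul]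
      rw [mvfderiv_fun_mul hf (g.mdifferentiableAt_val hY hZ),
        mvfderiv_fun_mul hf (g.mdifferentiableAt_val hX hY),
        mlieBracket_smul_left hf hY, mlieBracket_smul_right hf hY]
      simp [g.symm x (Y x) (X x)]
      ring }

theorem isLeviCivita_leviCivita : g.IsLeviCivita g.leviCivita where
  torsion_free {X Y x} hX hY := by
    refine g.ext_val fun w ↦ ?_
    have hw := FiberBundle.mdifferentiableAt_extend 𝓘(ℝ, E) E w
    have h1 := g.val_leviCivitaFun hX hY hw
    have h2 := g.val_leviCivitaFun hY hX hw
    simp only [FiberBundle.extend_apply_self] at h1 h2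
    change g.val x (g.leviCivitaFun Y x (X x) - g.leviCivitaFun X x (Y x)) w = _
    rw [map_sub, _root_.sub_apply, h1, h2, koszul, koszul,
      mlieBracket_swap_apply (V := Y) (W := X)]
    simp only [g.symm _ (Y _) (X _), map_neg, _root_.neg_apply,
      FiberBundle.extend_apply_self]
    ring
  metric {Y Z x} u hY hZ := by
    have hu := FiberBundle.mdifferentiableAt_extend 𝓘(ℝ, E) E u
    have h1 := g.val_leviCivitaFun hu hY hZ
    have h2 := g.val_leviCivitaFun hu hZ hY
    simp only [FiberBundle.extend_apply_self] at h1 h2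
    change _ = g.val x (g.leviCivitaFun Y x u) (Z x) + g.val x (Y x) (g.leviCivitaFun Z x u)
    rw [g.symm x (Y x), h1, h2, koszul, koszul, mlieBracket_swap_apply (V := Z) (W := Y)]
    simp only [g.symm _ (Z _) (Y _), map_neg, _root_.neg_apply,
      FiberBundle.extend_apply_self]
    ring
end PseudoRiemannianMetric

variable {E' : Type*} [NormedAddCommGroup E'] [NormedSpace ℝ E'] [FiniteDimensional ℝ E']
  {M' : Type*} [TopologicalSpace M'] [ChartedSpace E' M'] [IsManifold 𝓘(ℝ, E') ∞ M']

namespace PseudoRiemannianMetric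

/-- The pullback `(u, v) ↦ g (dι u) (dι v)` of a metric along a map `ι`, as a bilinear form. -/
def pullbackForm (g : PseudoRiemannianMetric E' M') (ι : M → M') (x : M) :
    TangentSpace 𝓘(ℝ, E) x →L[ℝ] TangentSpace 𝓘(ℝ, E) x →L[ℝ] ℝ :=
  ContinuousLinearMap.precomp ℝ (mfderiv 𝓘(ℝ, E) 𝓘(ℝ, E') ι x) ∘L g.val (ι x) ∘L
    (mfderiv 𝓘(ℝ, E) 𝓘(ℝ, E') ι x)

theorem inCoordinates_form (x₀ x : M)
    (hx : x ∈ (trivializationAt E (TangentSpace 𝓘(ℝ, E)) x₀).baseSet)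
    (φ : TangentSpace 𝓘(ℝ, E) x →L[ℝ] TangentSpace 𝓘(ℝ, E) x →L[ℝ] ℝ) (u v : E) :
    ContinuousLinearMap.inCoordinates E (TangentSpace 𝓘(ℝ, E)) (E →L[ℝ] ℝ)
      (fun y : M ↦ TangentSpace 𝓘(ℝ, E) y →L[ℝ] ℝ) x₀ x x₀ x φ u v =
    φ ((trivializationAt E (TangentSpace 𝓘(ℝ, E)) x₀).symmL ℝ x u)
      ((trivializationAt E (TangentSpace 𝓘(ℝ, E)) x₀).symmL ℝ x v) := by
  rw [inCoordinates_apply_eq₂ hx hx (by simp)]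
  simp [Trivialization.symmL_apply _ hx]

open ContinuousLinearMap in
theorem contMDiff_pullbackForm (g : PseudoRiemannianMetric E' M') {ι : M → M'}
    (hι : ContMDiff 𝓘(ℝ, E) 𝓘(ℝ, E') ∞ ι) :
    ContMDiff 𝓘(ℝ, E) (𝓘(ℝ, E).prod 𝓘(ℝ, E →L[ℝ] E →L[ℝ] ℝ)) ∞
      (fun x : M ↦ TotalSpace.mk' (E →L[ℝ] E →L[ℝ] ℝ)
        (E := fun x : M ↦ TangentSpace 𝓘(ℝ, E) x →L[ℝ] TangentSpace 𝓘(ℝ, E) x →L[ℝ] ℝ) x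
        (g.pullbackForm ι x)) := by
  intro x₀
  rw [contMDiffAt_hom_bundle]
  refine ⟨contMDiffAt_id, ?_⟩
  have hA := (hι x₀).mfderiv_const (m := ∞) (by simp)
  have hG := ((contMDiffAt_hom_bundle _).1 (g.contMDiff (ι x₀))).2.comp x₀ (hι x₀)
  have hL : ContMDiff 𝓘(ℝ, E →L[ℝ] E') 𝓘(ℝ, (E' →L[ℝ] ℝ) →L[ℝ] (E →L[ℝ] ℝ)) ∞
      (fun A ↦ (compL ℝ E E' ℝ).flip A) := ContinuousLinearMap.contMDiff _
  refine (((hL _).comp x₀ hA).clm_comp (hG.clm_comp hA)).congr_of_eventuallyEq ?_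
  have A : ∀ᶠ x in nhds x₀, x ∈ (trivializationAt E (TangentSpace 𝓘(ℝ, E)) x₀).baseSet :=
    (trivializationAt E (TangentSpace 𝓘(ℝ, E)) x₀).open_baseSet.mem_nhds
      (FiberBundle.mem_baseSet_trivializationAt' x₀)
  have B : ∀ᶠ x in nhds x₀, ι x ∈ (trivializationAt E' (TangentSpace 𝓘(ℝ, E')) (ι x₀)).baseSet :=
    hι.continuous.continuousAt.preimage_mem_nhds
    ((trivializationAt E' (TangentSpace 𝓘(ℝ, E')) (ι x₀)).open_baseSet.mem_nhds
      (FiberBundle.mem_baseSet_trivializationAt' (ι x₀)))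
  filter_upwards [A, B] with x hx hx'
  ext u v
  have key : ∀ w : E, (trivializationAt E' (TangentSpace 𝓘(ℝ, E')) (ι x₀)).symmL ℝ (ι x)
      (inTangentCoordinates 𝓘(ℝ, E) 𝓘(ℝ, E') id ι
        (fun x ↦ mfderiv 𝓘(ℝ, E) 𝓘(ℝ, E') ι x) x₀ x w) =
      mfderiv 𝓘(ℝ, E) 𝓘(ℝ, E') ι x
        ((trivializationAt E (TangentSpace 𝓘(ℝ, E)) x₀).symmL ℝ x w) := by
    intro w
    simp only [inTangentCoordinates, inCoordinates, ContinuousLinearMap.coe_comp,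
      Function.comp_apply, id]
    exact (trivializationAt E' (TangentSpace 𝓘(ℝ, E')) (ι x₀)).symmL_continuousLinearMapAt hx' _
  rw [inCoordinates_form _ _ hx]
  simp only [ContinuousLinearMap.coe_comp, Function.comp_apply, flip_apply, compL_apply]
  trans g.val (ι x) (mfderiv 𝓘(ℝ, E) 𝓘(ℝ, E') ι x
      ((trivializationAt E (TangentSpace 𝓘(ℝ, E)) x₀).symmL ℝ x u))
    (mfderiv 𝓘(ℝ, E) 𝓘(ℝ, E') ι x ((trivializationAt E (TangentSpace 𝓘(ℝ, E)) x₀).symmL ℝ x v))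
  · rfl
  · rw [← key, ← key]
    exact (inCoordinates_form _ _ hx' _ _ _).symm

end PseudoRiemannianMetric

/-- The covariant derivative of a field of endomorphisms `J`:
`covDerivEnd cov J Y x u = (∇_u J) Y = ∇_u (J Y) - J (∇_u Y)` at the point `x`. -/
def covDerivEnd (cov : CovariantDerivative 𝓘(ℝ, E) E (TangentSpace 𝓘(ℝ, E) : M → Type _))
    (J : ∀ x : M, TangentSpace 𝓘(ℝ, E) x →L[ℝ] TangentSpace 𝓘(ℝ, E) x)
    (Y : ∀ x : M, TangentSpace 𝓘(ℝ, E) x) (x : M) :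
    TangentSpace 𝓘(ℝ, E) x →L[ℝ] TangentSpace 𝓘(ℝ, E) x :=
  cov (fun y ↦ J y (Y y)) x - J x ∘L cov Y x

theorem covDerivEnd_eq_extend
    (cov : CovariantDerivative 𝓘(ℝ, E) E (TangentSpace 𝓘(ℝ, E) : M → Type _))
    {J : ∀ x : M, TangentSpace 𝓘(ℝ, E) x →L[ℝ] TangentSpace 𝓘(ℝ, E) x}
    (hJ : ContMDiff 𝓘(ℝ, E) (𝓘(ℝ, E).prod 𝓘(ℝ, E →L[ℝ] E)) ∞
      (fun x : M ↦ TotalSpace.mk' (E →L[ℝ] E)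
        (E := fun x : M ↦ TangentSpace 𝓘(ℝ, E) x →L[ℝ] TangentSpace 𝓘(ℝ, E) x) x (J x)))
    {Y : ∀ x : M, TangentSpace 𝓘(ℝ, E) x} {x : M} (hY : MDiffAt (T% Y) x) :
    covDerivEnd cov J Y x = covDerivEnd cov J (FiberBundle.extend E (Y x)) x := by
  have hJY : ∀ {Y : ∀ x : M, TangentSpace 𝓘(ℝ, E) x}, MDiffAt (T% Y) x →
      MDiffAt (T% (fun y ↦ J y (Y y))) x := fun hY ↦
    MDifferentiableAt.clm_bundle_apply (F₁ := E) (F₂ := E) (b := id)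
      ((hJ x).mdifferentiableAt (by simp)) hY
  have ht : TensorialAt 𝓘(ℝ, E) E (fun Y ↦ covDerivEnd cov J Y x) x :=
    { smul := by
        intro f Y hf hY
        have h1 : (fun y ↦ J y ((f • Y) y)) = f • (fun y ↦ J y (Y y)) := by
          ext y; simp
        simp only [covDerivEnd]
        rw [h1, cov.isCovariantDerivativeOnUniv.leibniz (hJY hY) hf,
          cov.isCovariantDerivativeOnUniv.leibniz hY hf]
        ext u
        simp [smul_sub]
      add := by
        intro Y Y' hY hY'
        have h1 : (fun y ↦ J y ((Y + Y') y)) = (fun y ↦ J y (Y y)) + (fun y ↦ J y (Y' y)) := by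
          ext y; simp
        simp only [covDerivEnd]
        rw [h1, cov.isCovariantDerivativeOnUniv.add (hJY hY) (hJY hY'),
          cov.isCovariantDerivativeOnUniv.add hY hY']
        ext u
        simp
        abel }
  exact ht.pointwise hY (FiberBundle.mdifferentiableAt_extend ..) (by simp)

/-- The covariant derivative `∇_u V` at `x` of a vector field `V` along a map `ι : M → M'`, for a
connection `cov` on `M'`. In a local frame `(e i)` of `TM'` around `ι x`, the field is
`V = ∑ i, V i • e i ∘ ι` and `∇_u V = ∑ i, (d(V i) u • e i + V i • ∇_{dι u} (e i))`. -/
def covAlong (cov : CovariantDerivative 𝓘(ℝ, E') E' (TangentSpace 𝓘(ℝ, E') : M' → Type _))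
    (ι : M → M') (V : ∀ x : M, TangentSpace 𝓘(ℝ, E') (ι x)) (x : M) :
    TangentSpace 𝓘(ℝ, E) x →L[ℝ] TangentSpace 𝓘(ℝ, E') (ι x) :=
  let t := trivializationAt E' (TangentSpace 𝓘(ℝ, E') : M' → Type _) (ι x)
  let e := t.localFrame (finBasis ℝ E')
  let c := t.localFrameCoeff 𝓘(ℝ, E') (finBasis ℝ E')
  ∑ i, ((mvfderiv 𝓘(ℝ, E) (fun y ↦ c i (ι y) (V y)) x).smulRight (e i (ι x))
    + c i (ι x) (V x) • (cov (e i) (ι x) ∘L mfderiv 𝓘(ℝ, E) 𝓘(ℝ, E') ι x))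

theorem covAlong_comp
    (cov : CovariantDerivative 𝓘(ℝ, E') E' (TangentSpace 𝓘(ℝ, E') : M' → Type _))
    {ι : M → M'} {Y : ∀ y : M', TangentSpace 𝓘(ℝ, E') y} {x : M}
    (hι : MDifferentiableAt 𝓘(ℝ, E) 𝓘(ℝ, E') ι x) (hY : MDiffAt (T% Y) (ι x))
    (u : TangentSpace 𝓘(ℝ, E) x) :
    covAlong cov ι (fun y ↦ Y (ι y)) x u = cov Y (ι x) (mfderiv 𝓘(ℝ, E) 𝓘(ℝ, E') ι x u) := by
  let t := trivializationAt E' (TangentSpace 𝓘(ℝ, E') : M' → Type _) (ι x)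
  let e := t.localFrame (finBasis ℝ E')
  let c := t.localFrameCoeff 𝓘(ℝ, E') (finBasis ℝ E')
  have hx : ι x ∈ t.baseSet := FiberBundle.mem_baseSet_trivializationAt' (ι x)
  have he (i) : MDiffAt (T% (e i)) (ι x) :=
    (contMDiffAt_localFrame_of_mem 1 _ (finBasis ℝ E') i hx).mdifferentiableAt (by simp)
  have hc (i) : MDiffAt (fun y ↦ c i y (Y y)) (ι x) :=
    mdifferentiableAt_localFrameCoeff (finBasis ℝ E') hx hY i
  have hsum : ∀ s : Finset (Fin (finrank ℝ E')),
      cov (fun y ↦ ∑ i ∈ s, c i y (Y y) • e i y) (ι x)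
        = ∑ i ∈ s, (c i (ι x) (Y (ι x)) • cov (e i) (ι x)
          + (mvfderiv 𝓘(ℝ, E') (fun y ↦ c i y (Y y)) (ι x)).smulRight (e i (ι x))) := by
    intro s
    classical
    induction s using Finset.induction_on with
    | empty => 
      have := congrFun cov.zero (ι x)
      simp only [Finset.sum_empty]
      exact this
    | insert a s ha ih =>
      simp only [Finset.sum_insert ha]
      rw [← ih, ← cov.isCovariantDerivativeOnUniv.leibniz (he a) (hc a)]
      exact cov.isCovariantDerivativeOnUniv.add ((hc a).smul_section (he a))
        (.sum_section fun i _ ↦ (hc i).smul_section (he i))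
  have hY' : cov Y (ι x) = cov (fun y ↦ ∑ i, c i y (Y y) • e i y) (ι x) :=
    cov.isCovariantDerivativeOnUniv.congr_of_eventuallyEq hY
      (.sum_section fun i _ ↦ (hc i).smul_section (he i)) Filter.univ_mem
      (t.eventually_eq_localFrame_sum_coeff_smul (finBasis ℝ E') hx)
  rw [hY', hsum]
  simp only [covAlong, _root_.sum_apply]
  refine Finset.sum_congr rfl fun i _ ↦ ?_
  have : mvfderiv 𝓘(ℝ, E) (fun y ↦ c i (ι y) (Y (ι y))) x u =
      mvfderiv 𝓘(ℝ, E') (fun y ↦ c i y (Y y)) (ι x) (mfderiv 𝓘(ℝ, E) 𝓘(ℝ, E') ι x u) :=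
    DFunLike.congr_fun (mfderiv_comp x (hc i) hι) u
  change mvfderiv 𝓘(ℝ, E) (fun y ↦ c i (ι y) (Y (ι y))) x u • e i (ι x) +
    c i (ι x) (Y (ι x)) • cov (e i) (ι x) (mfderiv 𝓘(ℝ, E) 𝓘(ℝ, E') ι x u) = _
  rw [this, add_comm]
  rfl

/-- An almost hypercomplex manifold with Hermitian and Norden metrics: an almost hypercomplex
structure `(J₁, J₂, J₃)` and a pseudo-Riemannian metric `g` which is Hermitian for `J₁` and a Norden
metric for `J₂` and `J₃`. The index `α : Fin 3` stands for the number `α + 1`, so that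
`J 0 = J₁`, `J 1 = J₂`, `J 2 = J₃`, and `(α, α + 1, α + 2)` runs through the cyclic permutations.
The associated forms `g_α (X, Y) = g (J_α X, Y)` are determined by these data. -/
structure AlmostHypercomplexHN (E : Type*) [NormedAddCommGroup E] [NormedSpace ℝ E]
    (M : Type*) [TopologicalSpace M] [ChartedSpace E M] [IsManifold 𝓘(ℝ, E) ∞ M] where
  g : PseudoRiemannianMetric E M
  J : Fin 3 → ∀ x : M, TangentSpace 𝓘(ℝ, E) x →L[ℝ] TangentSpace 𝓘(ℝ, E) x
  contMDiff_J : ∀ α, ContMDiff 𝓘(ℝ, E) (𝓘(ℝ, E).prod 𝓘(ℝ, E →L[ℝ] E)) ∞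
    (fun x : M ↦ TotalSpace.mk' (E →L[ℝ] E)
      (E := fun x : M ↦ TangentSpace 𝓘(ℝ, E) x →L[ℝ] TangentSpace 𝓘(ℝ, E) x) x (J α x))
  J_sq : ∀ α x (u : TangentSpace 𝓘(ℝ, E) x), J α x (J α x u) = -u
  J_cyclic : ∀ α x (u : TangentSpace 𝓘(ℝ, E) x), J α x u = J (α + 1) x (J (α + 2) x u)
  J_anticomm : ∀ α x (u : TangentSpace 𝓘(ℝ, E) x), J α x u = -J (α + 2) x (J (α + 1) x u)
  hermitian : ∀ x (u v : TangentSpace 𝓘(ℝ, E) x), g.val x (J 0 x u) (J 0 x v) = g.val x u v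
  norden : ∀ α, α ≠ 0 → ∀ x (u v : TangentSpace 𝓘(ℝ, E) x),
    g.val x (J α x u) (J α x v) = -g.val x u v

namespace AlmostHypercomplexHN
variable (S : AlmostHypercomplexHN E M)

/-- The fundamental tensor `F_α (u, v, w) = g ((∇_u J_α) v) w`. The field `(∇ J_α) Y` depends on
`Y` only through its value at the point, see `covDerivEnd_eq_extend`. -/
def F (α : Fin 3) (x : M) (u v w : TangentSpace 𝓘(ℝ, E) x) : ℝ :=
  S.g.val x (covDerivEnd S.g.leviCivita (S.J α) (FiberBundle.extend E v) x u) w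

/-- The Lee form `θ_α (w) = ∑ i j, g^{ij} F_α (e_i, e_j, w)`, for a basis `(e_i)` of the tangent
space and the inverse matrix `(g^{ij})` of the matrix of the metric. -/
def leeForm (α : Fin 3) (x : M) : TangentSpace 𝓘(ℝ, E) x →L[ℝ] ℝ :=
  let e := finBasis ℝ (TangentSpace 𝓘(ℝ, E) x)
  let G : Matrix (Fin (finrank ℝ (TangentSpace 𝓘(ℝ, E) x)))
    (Fin (finrank ℝ (TangentSpace 𝓘(ℝ, E) x))) ℝ := Matrix.of fun i j ↦ S.g.val x (e i) (e j)
  ∑ i, ∑ j, G⁻¹ i j • S.g.val x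
    (covDerivEnd S.g.leviCivita (S.J α) (FiberBundle.extend E (e j)) x (e i))

theorem leeForm_apply (α : Fin 3) (x : M) (w : TangentSpace 𝓘(ℝ, E) x) :
    S.leeForm α x w = ∑ i, ∑ j, (Matrix.of fun i j ↦
      S.g.val x (finBasis ℝ (TangentSpace 𝓘(ℝ, E) x) i)
        (finBasis ℝ (TangentSpace 𝓘(ℝ, E) x) j))⁻¹ i j *
      S.F α x (finBasis ℝ (TangentSpace 𝓘(ℝ, E) x) i)
        (finBasis ℝ (TangentSpace 𝓘(ℝ, E) x) j) w := by
  simp [leeForm, F]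

/-- The vector `p_α` dual to the Lee form: `θ_α (w) = g (w, p_α)`. -/
def leeVector (α : Fin 3) (x : M) : TangentSpace 𝓘(ℝ, E) x := S.g.sharp x (S.leeForm α x)

/-- The Nijenhuis tensor of `J_α`. -/
def nijenhuis (α : Fin 3) (X Y : ∀ x : M, TangentSpace 𝓘(ℝ, E) x) (x : M) :
    TangentSpace 𝓘(ℝ, E) x :=
  mlieBracket 𝓘(ℝ, E) (fun y ↦ S.J α y (X y)) (fun y ↦ S.J α y (Y y)) x
    - S.J α x (mlieBracket 𝓘(ℝ, E) (fun y ↦ S.J α y (X y)) Y x)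
    - S.J α x (mlieBracket 𝓘(ℝ, E) X (fun y ↦ S.J α y (Y y)) x)
    - mlieBracket 𝓘(ℝ, E) X Y x

/-- The structure is hypercomplex: the Nijenhuis tensors of `J₁, J₂, J₃` vanish. -/
def IsHypercomplex : Prop :=
  ∀ (α : Fin 3) (X Y : ∀ x : M, TangentSpace 𝓘(ℝ, E) x) (x : M),
    CMDiffAt ∞ (T% X) x → CMDiffAt ∞ (T% Y) x → S.nijenhuis α X Y x = 0

/-- A `4n`-dimensional manifold of the class `𝒲`: the structure is hypercomplex, `F₁` is that of a
locally conformally Kähler manifold, and `F₂`, `F₃` are those of locally conformally Kähler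
manifolds with Norden metric. -/
structure IsW (n : ℕ) : Prop where
  hypercomplex : S.IsHypercomplex
  F_zero : ∀ x (u v w : TangentSpace 𝓘(ℝ, E) x),
    S.F 0 x u v w = 1 / (2 * (2 * (n : ℝ) - 1)) *
      (S.g.val x u v * S.leeForm 0 x w - S.g.val x u w * S.leeForm 0 x v
        - S.g.val x u (S.J 0 x v) * S.leeForm 0 x (S.J 0 x w)
        + S.g.val x u (S.J 0 x w) * S.leeForm 0 x (S.J 0 x v))
  F_ne_zero : ∀ α, α ≠ 0 → ∀ x (u v w : TangentSpace 𝓘(ℝ, E) x),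
    S.F α x u v w = 1 / (4 * (n : ℝ)) *
      (S.g.val x u v * S.leeForm α x w + S.g.val x u w * S.leeForm α x v
        + S.g.val x u (S.J α x v) * S.leeForm α x (S.J α x w)
        + S.g.val x u (S.J α x w) * S.leeForm α x (S.J α x v))

end AlmostHypercomplexHN

/-- `ι : M → M'` is an immersed holomorphic submanifold of `M'`: its tangent spaces are preserved by
`J₁, J₂, J₃` and the restriction of the metric to them is non-degenerate. -/
structure IsHolomorphicSubmanifold (S : AlmostHypercomplexHN E' M') (ι : M → M') : Prop where
  immersion : Manifold.IsImmersion 𝓘(ℝ, E) 𝓘(ℝ, E') ∞ ι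
  image_J : ∀ α x, S.J α (ι x) '' Set.range (mfderiv 𝓘(ℝ, E) 𝓘(ℝ, E') ι x) =
    Set.range (mfderiv 𝓘(ℝ, E) 𝓘(ℝ, E') ι x)
  nondegenerate : ∀ x (u : TangentSpace 𝓘(ℝ, E) x),
    (∀ v : TangentSpace 𝓘(ℝ, E) x, S.g.val (ι x) (mfderiv 𝓘(ℝ, E) 𝓘(ℝ, E') ι x u)
      (mfderiv 𝓘(ℝ, E) 𝓘(ℝ, E') ι x v) = 0) → u = 0

namespace IsHolomorphicSubmanifold
variable {S : AlmostHypercomplexHN E' M'} {ι : M → M'}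

/-- The metric induced on a holomorphic submanifold. -/
def metric (h : IsHolomorphicSubmanifold (E := E) S ι) : PseudoRiemannianMetric E M where
  val := S.g.pullbackForm ι
  symm _ _ _ := S.g.symm _ _ _
  nondegenerate := h.nondegenerate
  contMDiff := S.g.contMDiff_pullbackForm h.immersion.contMDiff

theorem metric_val (h : IsHolomorphicSubmanifold (E := E) S ι) (x : M)
    (u v : TangentSpace 𝓘(ℝ, E) x) : h.metric.val x u v =
      S.g.val (ι x) (mfderiv 𝓘(ℝ, E) 𝓘(ℝ, E') ι x u) (mfderiv 𝓘(ℝ, E) 𝓘(ℝ, E') ι x v) := rfl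

/-- The tangential part `w^⊤` of a vector `w` of the ambient manifold at a point of the submanifold,
as a tangent vector of the submanifold. -/
def tangentialPart (h : IsHolomorphicSubmanifold (E := E) S ι) (x : M) :
    TangentSpace 𝓘(ℝ, E') (ι x) →ₗ[ℝ] TangentSpace 𝓘(ℝ, E) x where
  toFun w := h.metric.sharp x (S.g.val (ι x) w ∘L mfderiv 𝓘(ℝ, E) 𝓘(ℝ, E') ι x)
  map_add' w w' := by simp [ContinuousLinearMap.add_comp]
  map_smul' c w := by simp [ContinuousLinearMap.smul_comp]

/-- The normal part `w^⊥ = w - w^⊤`. -/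
def normalPart (h : IsHolomorphicSubmanifold (E := E) S ι) (x : M) :
    TangentSpace 𝓘(ℝ, E') (ι x) →ₗ[ℝ] TangentSpace 𝓘(ℝ, E') (ι x) :=
  LinearMap.id - (mfderiv 𝓘(ℝ, E) 𝓘(ℝ, E') ι x).toLinearMap ∘ₗ h.tangentialPart x

theorem tangentialPart_add_normalPart (h : IsHolomorphicSubmanifold (E := E) S ι) (x : M)
    (w : TangentSpace 𝓘(ℝ, E') (ι x)) :
    mfderiv 𝓘(ℝ, E) 𝓘(ℝ, E') ι x (h.tangentialPart x w) + h.normalPart x w = w := by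
  simp [normalPart]

theorem val_normalPart (h : IsHolomorphicSubmanifold (E := E) S ι) (x : M)
    (w : TangentSpace 𝓘(ℝ, E') (ι x)) (v : TangentSpace 𝓘(ℝ, E) x) :
    S.g.val (ι x) (h.normalPart x w) (mfderiv 𝓘(ℝ, E) 𝓘(ℝ, E') ι x v) = 0 := by
  have : h.metric.val x (h.tangentialPart x w) v =
      S.g.val (ι x) w (mfderiv 𝓘(ℝ, E) 𝓘(ℝ, E') ι x v) := h.metric.val_sharp x _ v
  rw [h.metric_val] at this
  simp [normalPart, this]

theorem tangentialPart_mfderiv (h : IsHolomorphicSubmanifold (E := E) S ι) (x : M)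
    (v : TangentSpace 𝓘(ℝ, E) x) :
    h.tangentialPart x (mfderiv 𝓘(ℝ, E) 𝓘(ℝ, E') ι x v) = v :=
  h.metric.ext_val fun _ ↦ h.metric.val_sharp x _ _

/-- The restriction of `J_α` to a holomorphic submanifold. -/
def J (h : IsHolomorphicSubmanifold (E := E) S ι) (α : Fin 3) (x : M) :
    TangentSpace 𝓘(ℝ, E) x →L[ℝ] TangentSpace 𝓘(ℝ, E) x :=
  LinearMap.toContinuousLinearMap (h.tangentialPart x ∘ₗ
    (S.J α (ι x) ∘L mfderiv 𝓘(ℝ, E) 𝓘(ℝ, E') ι x).toLinearMap)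

theorem mfderiv_J (h : IsHolomorphicSubmanifold (E := E) S ι) (α : Fin 3) (x : M)
    (v : TangentSpace 𝓘(ℝ, E) x) : mfderiv 𝓘(ℝ, E) 𝓘(ℝ, E') ι x (h.J α x v) =
      S.J α (ι x) (mfderiv 𝓘(ℝ, E) 𝓘(ℝ, E') ι x v) := by
  obtain ⟨w, hw⟩ : S.J α (ι x) (mfderiv 𝓘(ℝ, E) 𝓘(ℝ, E') ι x v) ∈
      Set.range (mfderiv 𝓘(ℝ, E) 𝓘(ℝ, E') ι x) := by
    rw [← h.image_J α x]
    exact ⟨_, ⟨v, rfl⟩, rfl⟩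
  have : h.J α x v = w := by
    change h.tangentialPart x (S.J α (ι x) (mfderiv 𝓘(ℝ, E) 𝓘(ℝ, E') ι x v)) = w
    rw [← hw, h.tangentialPart_mfderiv]
  rw [this, hw]

/-- The second fundamental form `h (u, Y) = (∇̄_u Y)^⊥` at `x`, for a vector field `Y` on the
submanifold. -/
def secondFundamentalForm (h : IsHolomorphicSubmanifold (E := E) S ι)
    (x : M) (u : TangentSpace 𝓘(ℝ, E) x) (Y : ∀ x : M, TangentSpace 𝓘(ℝ, E) x) :
    TangentSpace 𝓘(ℝ, E') (ι x) :=
  h.normalPart x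
    (covAlong S.g.leviCivita ι (fun y ↦ mfderiv 𝓘(ℝ, E) 𝓘(ℝ, E') ι y (Y y)) x u)

/-- The shape operator `A_N u = -(∇̄_u N)^⊤` at `x`, for a normal vector field `N`. -/
def shapeOperator (h : IsHolomorphicSubmanifold (E := E) S ι)
    (N : ∀ x : M, TangentSpace 𝓘(ℝ, E') (ι x)) (x : M) (u : TangentSpace 𝓘(ℝ, E) x) :
    TangentSpace 𝓘(ℝ, E) x :=
  -h.tangentialPart x (covAlong S.g.leviCivita ι N x u)

/-- The normal connection `D_u N = (∇̄_u N)^⊥` at `x`, for a normal vector field `N`. -/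
def normalConnection (h : IsHolomorphicSubmanifold (E := E) S ι)
    (x : M) (u : TangentSpace 𝓘(ℝ, E) x) (N : ∀ x : M, TangentSpace 𝓘(ℝ, E') (ι x)) :
    TangentSpace 𝓘(ℝ, E') (ι x) :=
  h.normalPart x (covAlong S.g.leviCivita ι N x u)

/-- `N` is a normal vector field on the submanifold. -/
def IsNormalField (_h : IsHolomorphicSubmanifold (E := E) S ι)
    (N : ∀ x : M, TangentSpace 𝓘(ℝ, E') (ι x)) : Prop :=
  ∀ (x : M) (v : TangentSpace 𝓘(ℝ, E) x),
    S.g.val (ι x) (N x) (mfderiv 𝓘(ℝ, E) 𝓘(ℝ, E') ι x v) = 0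

end IsHolomorphicSubmanifold

end

end

/-! All the formulas come from one identity. For a field `V` along `ι`, `∇̄_u (J_α V) = J_α (∇̄_u V)
+ (∇̄_{dι u} J_α) V` (`covAlong_endomorphism`), and on a 𝒲-manifold the last term is an explicit
vector built from `g`, `J_α` and `p_α`. Since `J_α` preserves `dι(TM)` and is self-adjoint up to
sign, it also preserves the normal spaces, so both projections commute with it (`tangentialPart_J`,
`normalPart_J`). For `V` tangent, the tangential part gives `∇ J_α`; for `V` normal, the two parts
give the shape operators and `D`, and `(∇̄_u J_α) V` is then tangent.

For `V` tangent, the normal part reads `h(X, J_α Y) = J_α h(X, Y) + g(X, Y) k_α + g(X, J_α Y) J_α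
k_α`, where `k_α` is a multiple of `p_α^⊥`. With the symmetry of `h` this gives `h(J_α X, J_α Y) =
-h(X, Y) + (g(X, Y) + g(J_α X, J_α Y)) J_α k_α`. The bracket vanishes for the Norden structures
`J₂`, `J₃`, so `h` is invariant under `J₁ = J₂ J₃`; for the Hermitian `J₁` the bracket is `2 g(X,
Y)`, whence `h = g J₁ k₁`. Putting this back into the relation for `α` makes `J_α k_α` agree with
`J₁ k₁` wherever `g` does not vanish (`eq_smul_of_quaternionic`).

What remains is the geometry of `covAlong`: it is metric (`covAlong_metric`) and torsion-free
(`covAlong_mfderiv_symm`). Hence `h` is symmetric, and by Koszul's formula the tangential part of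
`∇̄` is the Levi-Civita connection of the induced metric (`leviCivita_metric`). -/

set_option linter.unusedSectionVars false

/-! ### Coordinate vector fields: vanishing brackets and commuting derivatives. -/

section CoordinateFields
variable {E : Type*} [NormedAddCommGroup E] [NormedSpace ℝ E]
  {M : Type*} [TopologicalSpace M] [ChartedSpace E M] [IsManifold 𝓘(ℝ, E) ∞ M]

/-- The vector field which is constant in the preferred chart at `x`. -/
noncomputable def coordField (x : M) (v : E) (y : M) : TangentSpace 𝓘(ℝ, E) y :=
  (trivializationAt E (TangentSpace 𝓘(ℝ, E)) x).symm y v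

theorem coordField_eq_mfderivWithin {x y : M} (hy : y ∈ (chartAt E x).source) (v : E) :
    coordField x v y = mfderivWithin 𝓘(ℝ, E) 𝓘(ℝ, E) (extChartAt 𝓘(ℝ, E) x).symm
      (Set.range 𝓘(ℝ, E)) (extChartAt 𝓘(ℝ, E) x y) v := by
  have h := DFunLike.congr_fun (TangentBundle.symmL_trivializationAt (I := 𝓘(ℝ, E)) hy) v
  exact (Trivialization.symmL_apply (R := ℝ) _ hy v).symm.trans h

theorem coordField_eq_extend (x : M) (v : E) :
    coordField x v = FiberBundle.extend E (coordField x v x) := by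
  ext y
  have := (trivializationAt E (TangentSpace 𝓘(ℝ, E)) x).apply_mk_symm
    (FiberBundle.mem_baseSet_trivializationAt' x) v
  simp only [FiberBundle.extend, coordField, this]

theorem mdifferentiableAt_coordField (x : M) (v : E) : MDiffAt (T% (coordField x v)) x := by
  rw [coordField_eq_extend]
  exact FiberBundle.mdifferentiableAt_extend ..

theorem exists_coordField_eq (x : M) (u : TangentSpace 𝓘(ℝ, E) x) :
    ∃ v, coordField x v x = u := by
  refine ⟨(trivializationAt E (TangentSpace 𝓘(ℝ, E)) x ⟨x, u⟩).2, ?_⟩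
  exact (trivializationAt E (TangentSpace 𝓘(ℝ, E)) x).symm_apply_apply_mk
    (FiberBundle.mem_baseSet_trivializationAt' x) u

/-- Pulled back through the chart, both fields are constant near the point, so their bracket in the
model space is zero. -/
theorem mlieBracket_coordField (x : M) (v w : E) :
    mlieBracket 𝓘(ℝ, E) (coordField x v) (coordField x w) x = 0 := by
  have key (v : E) : mpullbackWithin 𝓘(ℝ, E) 𝓘(ℝ, E) (extChartAt 𝓘(ℝ, E) x).symm (coordField x v)
      (Set.range 𝓘(ℝ, E)) =ᶠ[nhds (extChartAt 𝓘(ℝ, E) x x)] fun _ ↦ v := by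
    filter_upwards [extChartAt_target_mem_nhds x] with z hz
    have hz' : (extChartAt 𝓘(ℝ, E) x).symm z ∈ (chartAt E x).source := by
      simpa using (extChartAt 𝓘(ℝ, E) x).map_target hz
    rw [mpullbackWithin_apply, coordField_eq_mfderivWithin hz',
      (extChartAt 𝓘(ℝ, E) x).right_inv hz]
    exact (isInvertible_mfderivWithin_extChartAt_symm hz).inverse_apply_eq.2 rfl
  have : lieBracketWithin ℝ
      (mpullbackWithin 𝓘(ℝ, E) 𝓘(ℝ, E) (extChartAt 𝓘(ℝ, E) x).symm (coordField x v)
        (Set.range 𝓘(ℝ, E)))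
      (mpullbackWithin 𝓘(ℝ, E) 𝓘(ℝ, E) (extChartAt 𝓘(ℝ, E) x).symm (coordField x w)
        (Set.range 𝓘(ℝ, E)))
      ((extChartAt 𝓘(ℝ, E) x).symm ⁻¹' Set.univ ∩ Set.range 𝓘(ℝ, E))
      (extChartAt 𝓘(ℝ, E) x x) = (0 : E) := by
    refine (Filter.EventuallyEq.lieBracketWithin_vectorField_eq_nhds
      (key v) (key w)).trans ?_
    simp [lieBracketWithin]
  rw [← mlieBracketWithin_univ, mlieBracketWithin_apply]
  exact (congrArg _ this).trans (map_zero _)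

/-- In the chart at `x` the iterated derivative is the second Fréchet derivative of `f ∘ φ.symm`,
which is symmetric for a `C²` function. -/
theorem mvfderiv_mvfderiv_coordField_comm {f : M → ℝ} {x : M}
    (hf : ContMDiffAt 𝓘(ℝ, E) 𝓘(ℝ, ℝ) 2 f x) (v w : E) :
    d% (fun y ↦ d% f y (coordField x v y)) x (coordField x w x) =
      d% (fun y ↦ d% f y (coordField x w y)) x (coordField x v x) := by
  set φ := extChartAt 𝓘(ℝ, E) x with hφ
  have hfφ : ContDiffAt ℝ 2 (f ∘ φ.symm) (φ x) := by
    have := ((_root_.contMDiffAt_iff (I := 𝓘(ℝ, E)) (I' := 𝓘(ℝ, ℝ))).1 hf).2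
    simp only [modelWithCornersSelf_coe, Set.range_id, contDiffWithinAt_univ] at this
    exact this
  have key (v : E) : (fun y ↦ d% f y (coordField x v y)) =ᶠ[nhds x]
      fun y ↦ fderiv ℝ (f ∘ φ.symm) (φ y) v := by
    filter_upwards [extChartAt_source_mem_nhds (I := 𝓘(ℝ, E)) x,
      (contMDiffAt_iff_contMDiffAt_nhds (by simp)).1 hf] with y hy hfy
    have hy' : φ y ∈ φ.target := φ.map_source hy
    have h1 := mdifferentiableWithinAt_extChartAt_symm (I := 𝓘(ℝ, E)) hy'
    simp only [modelWithCornersSelf_coe, Set.range_id, mdifferentiableWithinAt_univ] at h1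
    rw [coordField_eq_mfderivWithin (by simpa using hy)]
    simp only [modelWithCornersSelf_coe, Set.range_id, mfderivWithin_univ]
    have h2 := mvfderiv_comp_apply_of_eq (g := f) (φ y) (hfy.mdifferentiableAt (by simp)) h1
      (φ.left_inv hy) v
    exact h2.symm.trans (by rw [mvfderiv, mfderiv_eq_fderiv]; rfl)
  have hd (v w : E) : d% (fun y ↦ d% f y (coordField x v y)) x (coordField x w x) =
      fderiv ℝ (fderiv ℝ (f ∘ φ.symm)) (φ x) w v := by
    have h0 : d% (fun y ↦ d% f y (coordField x v y)) x =
      d% (fun y ↦ fderiv ℝ (f ∘ φ.symm) (φ y) v) x := (key v).mfderiv_eq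
    have h1 : DifferentiableAt ℝ (fun z ↦ fderiv ℝ (f ∘ φ.symm) z v) (φ x) := by
      have := (hfφ.fderiv_right (m := 1) (by norm_num)).differentiableAt (by simp)
      exact this.clm_apply (differentiableAt_const v)
    have h2 := mvfderiv_comp_apply x h1.mdifferentiableAt
      (mdifferentiableAt_extChartAt (I := 𝓘(ℝ, E)) (mem_chart_source E x)) (coordField x w x)
    rw [h0]
    refine h2.trans ?_
    rw [coordField_eq_mfderivWithin (mem_chart_source E x)]
    have h3 := DFunLike.congr_fun (mfderiv_extChartAt_comp_mfderivWithin_extChartAt_symm'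
      (I := 𝓘(ℝ, E)) (mem_extChartAt_source x)) w
    have h4 : d% (fun z ↦ fderiv ℝ (f ∘ φ.symm) z v) (φ x) w =
        fderiv ℝ (fderiv ℝ (f ∘ φ.symm)) (φ x) w v := by
      rw [mvfderiv, mfderiv_eq_fderiv]
      have := (hfφ.fderiv_right (m := 1) (by norm_num)).differentiableAt (by simp)
      have h5 := fderiv_clm_apply this (differentiableAt_const v)
      simp at h5
      exact (DFunLike.congr_fun h5 w).trans rfl
    exact (congrArg (d% (fun z ↦ fderiv ℝ (f ∘ φ.symm) z v) (φ x)) h3).trans h4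
  rw [hd, hd]
  exact (hfφ.isSymmSndFDerivAt (by simp)) _ _
end CoordinateFields

/-! ### Vector fields along a map: differentiability, tensoriality, rules for `covAlong`. -/

section Along
variable {E : Type*} [NormedAddCommGroup E] [NormedSpace ℝ E]
  {M : Type*} [TopologicalSpace M] [ChartedSpace E M]
  {E' : Type*} [NormedAddCommGroup E'] [NormedSpace ℝ E'] [FiniteDimensional ℝ E']
  {M' : Type*} [TopologicalSpace M'] [ChartedSpace E' M'] [IsManifold 𝓘(ℝ, E') ∞ M']

variable (E) in
/-- Differentiability at `x` of a vector field along a map `ι`. -/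
def MDiffAlongAt (ι : M → M') (V : ∀ x : M, TangentSpace 𝓘(ℝ, E') (ι x)) (x : M) : Prop :=
  MDifferentiableAt 𝓘(ℝ, E) 𝓘(ℝ, E').tangent (fun y ↦ (⟨ι y, V y⟩ : TangentBundle 𝓘(ℝ, E') M')) x

/-- The coefficients of a tangent vector in the local frame used in `covAlong`. -/
noncomputable abbrev frameCoeff (x₀ : M') (i : Fin (finrank ℝ E')) (y : M') :
    TangentSpace 𝓘(ℝ, E') y →ₗ[ℝ] ℝ :=
  (trivializationAt E' (TangentSpace 𝓘(ℝ, E') : M' → Type _) x₀).localFrameCoeff 𝓘(ℝ, E')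
    (finBasis ℝ E') i y

/-- The local frame used in `covAlong`. -/
noncomputable abbrev frame (x₀ : M') (i : Fin (finrank ℝ E')) (y : M') : TangentSpace 𝓘(ℝ, E') y :=
  (trivializationAt E' (TangentSpace 𝓘(ℝ, E') : M' → Type _) x₀).localFrame (finBasis ℝ E') i y

theorem frameCoeff_eq_repr {x₀ y : M'} (hy : y ∈ (chartAt E' x₀).source) (i)
    (w : TangentSpace 𝓘(ℝ, E') y) : frameCoeff x₀ i y w = (finBasis ℝ E').repr
      (trivializationAt E' (TangentSpace 𝓘(ℝ, E') : M' → Type _) x₀ ⟨y, w⟩).2 i := by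
  have := Trivialization.localFrameCoeff_eq_coeff (I := 𝓘(ℝ, E')) (b := finBasis ℝ E')
    (e := trivializationAt E' (TangentSpace 𝓘(ℝ, E') : M' → Type _) x₀)
    (s := FiberBundle.extend E' w) hy (i := i)
  simpa using this

theorem mdiffAt_frame (x₀ : M') (i) : MDiffAt (T% (frame (E' := E') x₀ i)) x₀ :=
  (contMDiffAt_localFrame_of_mem 1 _ (finBasis ℝ E') i
    (FiberBundle.mem_baseSet_trivializationAt' x₀)).mdifferentiableAt (by simp)

theorem sum_frameCoeff_smul_frame {x₀ y : M'} (hy : y ∈ (chartAt E' x₀).source)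
    (w : TangentSpace 𝓘(ℝ, E') y) : ∑ i, frameCoeff x₀ i y w • frame x₀ i y = w := by
  have := Trivialization.eq_sum_localFrameCoeff_smul (I := 𝓘(ℝ, E')) (b := finBasis ℝ E')
    (e := trivializationAt E' (TangentSpace 𝓘(ℝ, E') : M' → Type _) x₀)
    (s := FiberBundle.extend E' w) hy
  simpa using this.symm

variable {ι : M → M'} {V W : ∀ x : M, TangentSpace 𝓘(ℝ, E') (ι x)} {x : M}

theorem MDiffAlongAt.mdifferentiableAt (hV : MDiffAlongAt E ι V x) :
    MDifferentiableAt 𝓘(ℝ, E) 𝓘(ℝ, E') ι x :=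
  ((mdifferentiableAt_totalSpace _ _).1 hV).1

theorem eventually_mem_source (hι : ContinuousAt ι x) :
    ∀ᶠ y in nhds x, ι y ∈ (chartAt E' (ι x)).source :=
  hι.preimage_mem_nhds ((chartAt E' (ι x)).open_source.mem_nhds (mem_chart_source E' (ι x)))

/-- Reduces differentiability to the scalar coefficients out of which `covAlong` is built. -/
theorem mdiffAlongAt_iff (hι : MDifferentiableAt 𝓘(ℝ, E) 𝓘(ℝ, E') ι x) :
    MDiffAlongAt E ι V x ↔ ∀ i, MDiffAt (fun y ↦ frameCoeff (ι x) i (ι y) (V y)) x := by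
  set t := trivializationAt E' (TangentSpace 𝓘(ℝ, E') : M' → Type _) (ι x)
  have h1 : MDiffAlongAt E ι V x ↔ MDiffAt (fun y ↦ (t ⟨ι y, V y⟩).2) x :=
    (mdifferentiableAt_totalSpace _ _).trans (and_iff_right hι)
  rw [h1]
  have h2 (i) : (fun y ↦ frameCoeff (ι x) i (ι y) (V y)) =ᶠ[nhds x]
      fun y ↦ (finBasis ℝ E').repr (t ⟨ι y, V y⟩).2 i := by
    filter_upwards [eventually_mem_source (E' := E') hι.continuousAt] with y hy
    exact frameCoeff_eq_repr hy i (V y)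
  have h3 (i) : MDiffAt (fun y ↦ frameCoeff (ι x) i (ι y) (V y)) x ↔
      MDiffAt (fun y ↦ (finBasis ℝ E').repr (t ⟨ι y, V y⟩).2 i) x := (h2 i).mdifferentiableAt_iff
  simp only [h3]
  refine ⟨fun h i ↦ ?_, fun h ↦ ?_⟩
  · exact (((finBasis ℝ E').coord i).toContinuousLinearMap.mdifferentiableAt).comp x h
  · have h4 := MDifferentiableAt.sum (t := Finset.univ) fun i _ ↦
      (h i).smul (mdifferentiableAt_const (c := finBasis ℝ E' i))
    refine h4.congr_of_eventuallyEq (.of_forall fun y ↦ ?_)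
    simp [Finset.sum_apply]

theorem MDiffAlongAt.coeff (hV : MDiffAlongAt E ι V x) (i) :
    MDiffAt (fun y ↦ frameCoeff (ι x) i (ι y) (V y)) x :=
  (mdiffAlongAt_iff hV.mdifferentiableAt).1 hV i

theorem MDiffAlongAt.add (hV : MDiffAlongAt E ι V x) (hW : MDiffAlongAt E ι W x) :
    MDiffAlongAt E ι (fun y ↦ V y + W y) x := by
  rw [mdiffAlongAt_iff hV.mdifferentiableAt]
  intro i
  simp only [map_add]
  exact (hV.coeff i).add (hW.coeff i)

theorem MDiffAlongAt.smul {f : M → ℝ} (hf : MDiffAt f x) (hV : MDiffAlongAt E ι V x) :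
    MDiffAlongAt E ι (fun y ↦ f y • V y) x := by
  rw [mdiffAlongAt_iff hV.mdifferentiableAt]
  intro i
  simp only [map_smul, smul_eq_mul]
  exact hf.mul (hV.coeff i)

theorem mdiffAlongAt_zero (hι : MDifferentiableAt 𝓘(ℝ, E) 𝓘(ℝ, E') ι x) :
    MDiffAlongAt E ι (fun y ↦ (0 : TangentSpace 𝓘(ℝ, E') (ι y))) x := by
  rw [mdiffAlongAt_iff hι]
  intro i
  simp only [map_zero]
  exact mdifferentiableAt_const

theorem mdiffAlongAt_sum {κ : Type*} (s : Finset κ) {V : κ → ∀ x : M, TangentSpace 𝓘(ℝ, E') (ι x)}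
    (hι : MDifferentiableAt 𝓘(ℝ, E) 𝓘(ℝ, E') ι x) (hV : ∀ i ∈ s, MDiffAlongAt E ι (V i) x) :
    MDiffAlongAt E ι (fun y ↦ ∑ i ∈ s, V i y) x := by
  classical
  induction s using Finset.induction_on with
  | empty => simpa using mdiffAlongAt_zero hι
  | insert a s ha ih =>
    simp only [Finset.sum_insert ha]
    exact (hV a (by simp)).add (ih fun i hi ↦ hV i (by simp [hi]))

theorem mdiffAlongAt_comp {Y : ∀ y : M', TangentSpace 𝓘(ℝ, E') y}
    (hι : MDifferentiableAt 𝓘(ℝ, E) 𝓘(ℝ, E') ι x) (hY : MDiffAt (T% Y) (ι x)) :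
    MDiffAlongAt E ι (fun y ↦ Y (ι y)) x :=
  MDifferentiableAt.comp x hY hι

variable (E) in
/-- A local and function-linear operation on the differentiable vector fields along `ι`. -/
structure TensorialAlongAt {A : Type*} [AddCommGroup A] [Module ℝ A] (ι : M → M')
    (Φ : (∀ x : M, TangentSpace 𝓘(ℝ, E') (ι x)) → A) (x : M) : Prop where
  congr : ∀ V W, (∀ᶠ y in nhds x, V y = W y) → Φ V = Φ W
  add : ∀ V W, MDiffAlongAt E ι V x → MDiffAlongAt E ι W x → Φ (fun y ↦ V y + W y) = Φ V + Φ W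
  smul : ∀ (f : M → ℝ) V, MDiffAt f x → MDiffAlongAt E ι V x → Φ (fun y ↦ f y • V y) = f x • Φ V

theorem TensorialAlongAt.eq_sum {A : Type*} [AddCommGroup A] [Module ℝ A]
    {Φ : (∀ x : M, TangentSpace 𝓘(ℝ, E') (ι x)) → A} (hΦ : TensorialAlongAt E ι Φ x)
    (hV : MDiffAlongAt E ι V x) :
    Φ V = ∑ i, frameCoeff (ι x) i (ι x) (V x) • Φ (fun y ↦ frame (ι x) i (ι y)) := by
  have hι := hV.mdifferentiableAt
  have he (i) : MDiffAlongAt E ι (fun y ↦ frame (ι x) i (ι y)) x :=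
    mdiffAlongAt_comp hι (mdiffAt_frame (ι x) i)
  have hs (s : Finset (Fin (finrank ℝ E'))) : Φ (fun y ↦ ∑ i ∈ s,
      frameCoeff (ι x) i (ι y) (V y) • frame (ι x) i (ι y)) =
      ∑ i ∈ s, frameCoeff (ι x) i (ι x) (V x) • Φ (fun y ↦ frame (ι x) i (ι y)) := by
    classical
    induction s using Finset.induction_on with
    -- `Φ 0 = 0` is function-linearity applied to the zero function.
    | empty => simpa using hΦ.smul (fun _ ↦ 0) V mdifferentiableAt_const hV
    | insert a s ha ih =>
      simp only [Finset.sum_insert ha]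
      rw [hΦ.add _ _ ((he a).smul (hV.coeff a))
        (mdiffAlongAt_sum s hι fun i _ ↦ (he i).smul (hV.coeff i)), ih,
        hΦ.smul (fun y ↦ frameCoeff (ι x) a (ι y) (V y)) _ (hV.coeff a) (he a)]
  rw [← hs Finset.univ]
  refine hΦ.congr _ _ ?_
  filter_upwards [eventually_mem_source (E' := E') hι.continuousAt] with y hy
  exact (sum_frameCoeff_smul_frame hy (V y)).symm

/-- The frame expansion of `Φ V` sees only `V x`. This lets an arbitrary field along `ι`, which need
not come from an ambient field, be replaced by one that does, where `covAlong_comp` applies. -/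
theorem TensorialAlongAt.eq_extend {A : Type*} [AddCommGroup A] [Module ℝ A]
    {Φ : (∀ x : M, TangentSpace 𝓘(ℝ, E') (ι x)) → A} (hΦ : TensorialAlongAt E ι Φ x)
    (hV : MDiffAlongAt E ι V x) :
    Φ V = Φ (fun y ↦ FiberBundle.extend E' (V x) (ι y)) := by
  rw [hΦ.eq_sum hV, hΦ.eq_sum (mdiffAlongAt_comp hV.mdifferentiableAt
    (FiberBundle.mdifferentiableAt_extend ..))]
  simp

variable (cov : CovariantDerivative 𝓘(ℝ, E') E' (TangentSpace 𝓘(ℝ, E') : M' → Type _))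

theorem covAlong_congr (h : ∀ᶠ y in nhds x, V y = W y) :
    covAlong (E := E) cov ι V x = covAlong cov ι W x := by
  have h' (i) : (fun y ↦ frameCoeff (ι x) i (ι y) (V y)) =ᶠ[nhds x]
      fun y ↦ frameCoeff (ι x) i (ι y) (W y) := h.mono fun y hy ↦ by simp [hy]
  simp only [covAlong, h.self_of_nhds]
  refine Finset.sum_congr rfl fun i _ ↦ ?_
  have h2 : mvfderiv 𝓘(ℝ, E) (fun y ↦ frameCoeff (ι x) i (ι y) (V y)) x =
      mvfderiv 𝓘(ℝ, E) (fun y ↦ frameCoeff (ι x) i (ι y) (W y)) x := (h' i).mfderiv_eq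
  exact congrArg₂ (· + ·) (by rw [h2]) rfl

theorem covAlong_add (hV : MDiffAlongAt E ι V x) (hW : MDiffAlongAt E ι W x) :
    covAlong (E := E) cov ι (fun y ↦ V y + W y) x = covAlong cov ι V x + covAlong cov ι W x := by
  simp only [covAlong, ← Finset.sum_add_distrib, map_add]
  refine Finset.sum_congr rfl fun i _ ↦ ?_
  rw [mvfderiv_fun_add (hV.coeff i) (hW.coeff i)]
  ext u
  simp
  module

theorem covAlong_smul {f : M → ℝ} (hf : MDiffAt f x) (hV : MDiffAlongAt E ι V x)
    (u : TangentSpace 𝓘(ℝ, E) x) :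
    covAlong (E := E) cov ι (fun y ↦ f y • V y) x u = f x • covAlong cov ι V x u
      + d% f x u • V x := by
  have h := sum_frameCoeff_smul_frame (mem_chart_source E' (ι x)) (V x)
  conv_rhs => rw [← h]
  simp only [covAlong, map_smul, smul_eq_mul, _root_.sum_apply, Finset.smul_sum,
    ← Finset.sum_add_distrib]
  refine Finset.sum_congr rfl fun i _ ↦ ?_
  rw [mvfderiv_fun_mul hf (hV.coeff i)]
  simp
  module
end Along

/-! ### Product rules along a map, and the metric and torsion-free properties. -/

section AlongRules
variable {E : Type*} [NormedAddCommGroup E] [NormedSpace ℝ E] [FiniteDimensional ℝ E]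
  {M : Type*} [TopologicalSpace M] [ChartedSpace E M] [IsManifold 𝓘(ℝ, E) ∞ M]
  {E' : Type*} [NormedAddCommGroup E'] [NormedSpace ℝ E'] [FiniteDimensional ℝ E']
  {M' : Type*} [TopologicalSpace M'] [ChartedSpace E' M'] [IsManifold 𝓘(ℝ, E') ∞ M']
  {ι : M → M'} {V W : ∀ x : M, TangentSpace 𝓘(ℝ, E') (ι x)} {x : M}

theorem MDiffAlongAt.endomorphism
    {J : ∀ x : M', TangentSpace 𝓘(ℝ, E') x →L[ℝ] TangentSpace 𝓘(ℝ, E') x}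
    (hJ : ContMDiff 𝓘(ℝ, E') (𝓘(ℝ, E').prod 𝓘(ℝ, E' →L[ℝ] E')) ∞
      (fun x : M' ↦ TotalSpace.mk' (E' →L[ℝ] E')
        (E := fun x : M' ↦ TangentSpace 𝓘(ℝ, E') x →L[ℝ] TangentSpace 𝓘(ℝ, E') x) x (J x)))
    (hV : MDiffAlongAt E ι V x) : MDiffAlongAt E ι (fun y ↦ J (ι y) (V y)) x := by
  have h := ((hJ (ι x)).mdifferentiableAt (by simp)).comp x hV.mdifferentiableAt
  exact MDifferentiableAt.clm_bundle_apply (F₁ := E') (F₂ := E') (b := ι) h hV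

/-- The defect `∇̄ (J V) - J (∇̄ V)` is tensorial in `V`, because the derivatives of a factor `f`
cancel. So `V` may be taken to be the restriction of an ambient field, and there the defect is
`covDerivEnd` by definition. -/
theorem covAlong_endomorphism
    (cov : CovariantDerivative 𝓘(ℝ, E') E' (TangentSpace 𝓘(ℝ, E') : M' → Type _))
    {J : ∀ x : M', TangentSpace 𝓘(ℝ, E') x →L[ℝ] TangentSpace 𝓘(ℝ, E') x}
    (hJ : ContMDiff 𝓘(ℝ, E') (𝓘(ℝ, E').prod 𝓘(ℝ, E' →L[ℝ] E')) ∞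
      (fun x : M' ↦ TotalSpace.mk' (E' →L[ℝ] E')
        (E := fun x : M' ↦ TangentSpace 𝓘(ℝ, E') x →L[ℝ] TangentSpace 𝓘(ℝ, E') x) x (J x)))
    (hV : MDiffAlongAt E ι V x) (u : TangentSpace 𝓘(ℝ, E) x) :
    covAlong cov ι (fun y ↦ J (ι y) (V y)) x u = J (ι x) (covAlong cov ι V x u) +
      covDerivEnd cov J (FiberBundle.extend E' (V x)) (ι x) (mfderiv 𝓘(ℝ, E) 𝓘(ℝ, E') ι x u) := by
  have ht : TensorialAlongAt E ι (fun V ↦ covAlong cov ι (fun y ↦ J (ι y) (V y)) x u -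
      J (ι x) (covAlong cov ι V x u)) x := by
    refine ⟨fun V W h ↦ ?_, fun V W hV hW ↦ ?_, fun f V hf hV ↦ ?_⟩
    · rw [covAlong_congr cov h, covAlong_congr cov (h.mono fun y hy ↦ by rw [hy])]
    · simp only [map_add, covAlong_add cov hV hW,
        covAlong_add cov (hV.endomorphism hJ) (hW.endomorphism hJ), _root_.add_apply]
      abel
    · simp only [map_smul, covAlong_smul cov hf hV,
        covAlong_smul cov hf (hV.endomorphism hJ), map_add]
      module
  have h := ht.eq_extend hV
  have hY := FiberBundle.mdifferentiableAt_extend 𝓘(ℝ, E') E' (V x)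
  have hJY : MDiffAt (T% (fun y ↦ J y (FiberBundle.extend E' (V x) y))) (ι x) :=
    MDifferentiableAt.clm_bundle_apply (F₁ := E') (F₂ := E') (b := id)
      ((hJ (ι x)).mdifferentiableAt (by simp)) hY
  simp only at h
  rw [covAlong_comp cov hV.mdifferentiableAt hY,
    covAlong_comp (Y := fun y ↦ J y (FiberBundle.extend E' (V x) y)) cov hV.mdifferentiableAt hJY]
    at h
  rw [sub_eq_iff_eq_add'] at h
  rw [h]
  rfl

theorem MDiffAlongAt.metric (g : PseudoRiemannianMetric E' M') (hV : MDiffAlongAt E ι V x)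
    (hW : MDiffAlongAt E ι W x) : MDiffAt (fun y ↦ g.val (ι y) (V y) (W y)) x := by
  have hg := ((g.contMDiff (ι x)).mdifferentiableAt (by simp)).comp x hV.mdifferentiableAt
  have := MDifferentiableAt.clm_bundle_apply₂ (F₁ := E') (F₂ := E') (F₃ := ℝ)
    (E₃ := fun _ : M' ↦ ℝ) (b := ι) hg hV hW
  exact (mdifferentiableAt_totalSpace _ _).1 this |>.2

theorem tensorialAlongAt_metric (g : PseudoRiemannianMetric E' M')
    (cov : CovariantDerivative 𝓘(ℝ, E') E' (TangentSpace 𝓘(ℝ, E') : M' → Type _))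
    (hW : MDiffAlongAt E ι W x) (u : TangentSpace 𝓘(ℝ, E) x) :
    TensorialAlongAt E ι (fun V ↦ d% (fun y ↦ g.val (ι y) (V y) (W y)) x u -
      (g.val (ι x) (covAlong cov ι V x u) (W x) + g.val (ι x) (V x) (covAlong cov ι W x u))) x := by
  refine ⟨fun V W' h ↦ ?_, fun V W' hV hW' ↦ ?_, fun f V hf hV ↦ ?_⟩
  · have h' : (fun y ↦ g.val (ι y) (V y) (W y)) =ᶠ[nhds x] fun y ↦ g.val (ι y) (W' y) (W y) :=
      h.mono fun y hy ↦ by simp [hy]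
    have h'' : d% (fun y ↦ g.val (ι y) (V y) (W y)) x = d% (fun y ↦ g.val (ι y) (W' y) (W y)) x :=
      h'.mfderiv_eq
    rw [covAlong_congr cov h, h'', h.self_of_nhds]
  · simp only [map_add, covAlong_add cov hV hW', _root_.add_apply]
    rw [mvfderiv_fun_add (hV.metric g hW) (hW'.metric g hW)]
    simp only [_root_.add_apply]
    ring
  · simp only [map_smul, covAlong_smul cov hf hV, map_add, _root_.smul_apply, smul_eq_mul,
      _root_.add_apply]
    rw [mvfderiv_fun_mul hf (hV.metric g hW)]
    simp only [_root_.add_apply, _root_.smul_apply, smul_eq_mul]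
    ring

/-- The failure of the product rule is tensorial in each argument, and it vanishes on restrictions
of ambient fields by the chain rule and `hcov.metric`. -/
theorem covAlong_metric {g : PseudoRiemannianMetric E' M'}
    {cov : CovariantDerivative 𝓘(ℝ, E') E' (TangentSpace 𝓘(ℝ, E') : M' → Type _)}
    (hcov : g.IsLeviCivita cov) (hV : MDiffAlongAt E ι V x) (hW : MDiffAlongAt E ι W x)
    (u : TangentSpace 𝓘(ℝ, E) x) :
    d% (fun y ↦ g.val (ι y) (V y) (W y)) x u =
      g.val (ι x) (covAlong cov ι V x u) (W x) + g.val (ι x) (V x) (covAlong cov ι W x u) := by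
  have hι := hV.mdifferentiableAt
  have hY := FiberBundle.mdifferentiableAt_extend 𝓘(ℝ, E') E' (V x)
  have hZ := FiberBundle.mdifferentiableAt_extend 𝓘(ℝ, E') E' (W x)
  have hY' : MDiffAlongAt E ι (fun y ↦ FiberBundle.extend E' (V x) (ι y)) x :=
    mdiffAlongAt_comp hι hY
  -- First `V` is replaced with `W` fixed, then `W` with the extension of `V` fixed. The second
  -- replacement uses the left slot of `g`, so the symmetry of `g` is needed to match the two.
  have h1 := (tensorialAlongAt_metric g cov hW u).eq_extend hV
  have h2 := (tensorialAlongAt_metric g cov hY' u).eq_extend hW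
  have h3 := hcov.metric (mfderiv 𝓘(ℝ, E) 𝓘(ℝ, E') ι x u) hZ hY
  have h4 := mvfderiv_comp_apply x (g.mdifferentiableAt_val hZ hY) hι u
  simp only [covAlong_comp cov hι hY, covAlong_comp cov hι hZ] at h1 h2
  have h5 : (fun y ↦ g.val (ι y) (W y) (FiberBundle.extend E' (V x) (ι y))) =
      fun y ↦ g.val (ι y) (FiberBundle.extend E' (V x) (ι y)) (W y) := by
    ext y
    exact g.symm _ _ _
  rw [← h4] at h3
  change d% (fun y ↦ g.val (ι y) (FiberBundle.extend E' (W x) (ι y))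
    (FiberBundle.extend E' (V x) (ι y))) x u = _ at h3
  rw [h3, sub_self, h5] at h2
  simp only [FiberBundle.extend_apply_self] at h1 h2
  rw [sub_eq_zero.1 h2] at h1
  have h6 := g.symm (ι x) (covAlong cov ι W x u) (V x)
  have h7 := g.symm (ι x) (W x)
    (cov (FiberBundle.extend E' (V x)) (ι x) (mfderiv 𝓘(ℝ, E) 𝓘(ℝ, E') ι x u))
  linarith

theorem mdiffAlongAt_mfderiv (hι : ContMDiffAt 𝓘(ℝ, E) 𝓘(ℝ, E') ∞ ι x)
    {Y : ∀ x : M, TangentSpace 𝓘(ℝ, E) x} (hY : MDiffAt (T% Y) x) :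
    MDiffAlongAt E ι (fun y ↦ mfderiv 𝓘(ℝ, E) 𝓘(ℝ, E') ι y (Y y)) x := by
  have h := hι.mfderiv_const (m := ∞) (by simp)
  have h' := h.mdifferentiableAt (by simp)
  exact MDifferentiableAt.clm_apply_of_inCoordinates h' hY (hι.mdifferentiableAt (by simp))

theorem mlieBracket_frame (x₀ : M') (i j) :
    mlieBracket 𝓘(ℝ, E') (frame (E' := E') x₀ i) (frame x₀ j) x₀ = 0 := by
  have h (i) : frame (E' := E') x₀ i =ᶠ[nhds x₀] coordField x₀ (finBasis ℝ E' i) := by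
    filter_upwards [(chartAt E' x₀).open_source.mem_nhds (mem_chart_source E' x₀)] with y hy
    rw [frame, Trivialization.localFrame_apply_of_mem_baseSet _ _ hy]
    simp only [Trivialization.basisAt, Basis.map_apply]
    rfl
  rw [(h i).mlieBracket_vectorField_eq (h j), mlieBracket_coordField]

/-- The tangent bundle trivialization is the derivative of the chart, so this is the chain rule for
the coordinate functions of `ι`. -/
theorem frameCoeff_mfderiv (hι : ContMDiffAt 𝓘(ℝ, E) 𝓘(ℝ, E') ∞ ι x) 
    (Y : ∀ x : M, TangentSpace 𝓘(ℝ, E) x) (i) :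
    (fun y ↦ frameCoeff (ι x) i (ι y) (mfderiv 𝓘(ℝ, E) 𝓘(ℝ, E') ι y (Y y))) =ᶠ[nhds x]
      fun y ↦ d% (fun z ↦ (finBasis ℝ E').coord i (extChartAt 𝓘(ℝ, E') (ι x) (ι z))) y (Y y) := by
  filter_upwards [eventually_mem_source (E' := E') hι.continuousAt,
    (contMDiffAt_iff_contMDiffAt_nhds (by simp)).1 (hι.of_le (m := 1) (by simp))] with y hy hιy
  have h1 := mdifferentiableAt_extChartAt (I := 𝓘(ℝ, E')) hy
  have h2 := ((finBasis ℝ E').coord i).toContinuousLinearMap.mdifferentiableAt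
    (x := extChartAt 𝓘(ℝ, E') (ι x) (ι y))
  have h3 := mvfderiv_comp_apply y (h2.comp (ι y) h1) (hιy.mdifferentiableAt (by simp)) (Y y)
  have h4 := mvfderiv_comp_apply (ι y) h2 h1 (mfderiv 𝓘(ℝ, E) 𝓘(ℝ, E') ι y (Y y))
  have h5 := DFunLike.congr_fun (TangentBundle.continuousLinearMapAt_trivializationAt
    (I := 𝓘(ℝ, E')) hy) (mfderiv 𝓘(ℝ, E) 𝓘(ℝ, E') ι y (Y y))
  have h6 := Trivialization.continuousLinearMapAt_apply_of_mem (R := ℝ)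
    (trivializationAt E' (TangentSpace 𝓘(ℝ, E') : M' → Type _) (ι x)) hy
    (mfderiv 𝓘(ℝ, E) 𝓘(ℝ, E') ι y (Y y))
  have h7 (z w : E') : d% ((finBasis ℝ E').coord i).toContinuousLinearMap z w =
      (finBasis ℝ E').coord i w := by
    rw [mvfderiv, mfderiv_eq_fderiv, ContinuousLinearMap.fderiv]
    rfl
  rw [frameCoeff_eq_repr hy]
  refine Eq.trans ?_ h3.symm
  refine Eq.trans ?_ h4.symm
  refine Eq.trans ?_ (h7 _ _).symm
  exact congrArg ((finBasis ℝ E').coord i) (h6.symm.trans h5)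

theorem contMDiffAt_coord_comp (hι : ContMDiffAt 𝓘(ℝ, E) 𝓘(ℝ, E') ∞ ι x) (i) :
    ContMDiffAt 𝓘(ℝ, E) 𝓘(ℝ, ℝ) 2
      (fun z ↦ (finBasis ℝ E').coord i (extChartAt 𝓘(ℝ, E') (ι x) (ι z))) x := by
  have h1 := (contMDiffAt_extChartAt (I := 𝓘(ℝ, E')) (n := ∞) (x := ι x)).comp x hι
  have h2 := ((finBasis ℝ E').coord i).toContinuousLinearMap.contMDiffAt (n := ∞)
    (x := extChartAt 𝓘(ℝ, E') (ι x) (ι x))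
  exact (h2.comp x h1).of_le (by norm_cast)

/-- The torsion of the pulled-back connection is tensorial in `X` and `Y`, so coordinate fields
suffice. For these, the second derivatives of the components of `ι` commute, and the Christoffel
terms are symmetric because the ambient connection is torsion-free and the frame fields have zero
bracket at the base point. -/
theorem covAlong_mfderiv_symm {g : PseudoRiemannianMetric E' M'}
    {cov : CovariantDerivative 𝓘(ℝ, E') E' (TangentSpace 𝓘(ℝ, E') : M' → Type _)}
    (hcov : g.IsLeviCivita cov) (hι : ContMDiffAt 𝓘(ℝ, E) 𝓘(ℝ, E') ∞ ι x)
    {X Y : ∀ x : M, TangentSpace 𝓘(ℝ, E) x} (hX : MDiffAt (T% X) x) (hY : MDiffAt (T% Y) x) :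
    covAlong cov ι (fun y ↦ mfderiv 𝓘(ℝ, E) 𝓘(ℝ, E') ι y (Y y)) x (X x) -
      covAlong cov ι (fun y ↦ mfderiv 𝓘(ℝ, E) 𝓘(ℝ, E') ι y (X y)) x (Y x) =
    mfderiv 𝓘(ℝ, E) 𝓘(ℝ, E') ι x (mlieBracket 𝓘(ℝ, E) X Y x) := by
  rw [← sub_eq_zero]
  set T : (∀ x : M, TangentSpace 𝓘(ℝ, E) x) → (∀ x : M, TangentSpace 𝓘(ℝ, E) x) →
      TangentSpace 𝓘(ℝ, E') (ι x) := fun X Y ↦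
    covAlong cov ι (fun y ↦ mfderiv 𝓘(ℝ, E) 𝓘(ℝ, E') ι y (Y y)) x (X x) -
      covAlong cov ι (fun y ↦ mfderiv 𝓘(ℝ, E) 𝓘(ℝ, E') ι y (X y)) x (Y x) -
    mfderiv 𝓘(ℝ, E) 𝓘(ℝ, E') ι x (mlieBracket 𝓘(ℝ, E) X Y x) with hT
  -- Antisymmetry transfers tensoriality from the first argument to the second.
  have hanti (X Y) : T X Y = - T Y X := by
    simp only [hT]
    rw [mlieBracket_swap_apply (V := Y) (W := X), map_neg]
    abel
  have h1 (Y) : MDiffAt (T% Y) x → TensorialAt 𝓘(ℝ, E) E (fun X ↦ T X Y) x := by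
    intro hY
    refine ⟨fun {f X} hf hX ↦ ?_, fun {X X'} hX hX' ↦ ?_⟩
    · simp only [hT, Pi.smul_apply', map_smul, mlieBracket_smul_left hf hX,
        covAlong_smul cov hf (mdiffAlongAt_mfderiv hι hX), map_add]
      module
    · simp only [hT, Pi.add_apply, map_add, mlieBracket_add_left hX hX',
        covAlong_add cov (mdiffAlongAt_mfderiv hι hX) (mdiffAlongAt_mfderiv hι hX'),
        _root_.add_apply]
      abel
  have h2 (X) : MDiffAt (T% X) x → TensorialAt 𝓘(ℝ, E) E (fun Y ↦ T X Y) x := by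
    intro hX
    have h := h1 X hX
    refine ⟨fun {f Y} hf hY ↦ ?_, fun {Y Y'} hY hY' ↦ ?_⟩
    · rw [hanti, h.smul hf hY, hanti Y, smul_neg, neg_neg]
    · rw [hanti, h.add hY hY', hanti Y, hanti Y', neg_add, neg_neg, neg_neg]
  obtain ⟨v, hv⟩ := exists_coordField_eq x (X x)
  obtain ⟨w, hw⟩ := exists_coordField_eq x (Y x)
  have hcv := mdifferentiableAt_coordField x v
  have hcw := mdifferentiableAt_coordField x w
  change T X Y = 0
  rw [(h1 Y hY).pointwise hX hcv hv.symm, (h2 _ hcv).pointwise hY hcw hw.symm]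
  simp only [hT, mlieBracket_coordField, map_zero, sub_zero]
  set a := mfderiv 𝓘(ℝ, E) 𝓘(ℝ, E') ι x (coordField x v x)
  set b := mfderiv 𝓘(ℝ, E) 𝓘(ℝ, E') ι x (coordField x w x)
  have hfirst (v w : E) (i) : d% (fun y ↦ frameCoeff (ι x) i (ι y)
      (mfderiv 𝓘(ℝ, E) 𝓘(ℝ, E') ι y (coordField x v y))) x (coordField x w x) =
      d% (fun y ↦ d% (fun z ↦ (finBasis ℝ E').coord i (extChartAt 𝓘(ℝ, E') (ι x) (ι z))) y
        (coordField x v y)) x (coordField x w x) :=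
    DFunLike.congr_fun (frameCoeff_mfderiv hι (coordField x v) i).mfderiv_eq _
  have hframe (i j) : cov (frame (ι x) i) (ι x) (frame (ι x) j (ι x)) =
      cov (frame (ι x) j) (ι x) (frame (ι x) i (ι x)) := by
    rw [← sub_eq_zero, hcov.torsion_free (mdiffAt_frame _ j) (mdiffAt_frame _ i),
      mlieBracket_frame]
  -- Symmetry of the Christoffel terms, after expanding the direction in the frame as well.
  have hsecond : ∑ i, frameCoeff (ι x) i (ι x) a • cov (frame (ι x) i) (ι x) b =
      ∑ i, frameCoeff (ι x) i (ι x) b • cov (frame (ι x) i) (ι x) a := by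
    have hexp (a b : TangentSpace 𝓘(ℝ, E') (ι x)) :
        ∑ i, frameCoeff (ι x) i (ι x) a • cov (frame (ι x) i) (ι x) b =
        ∑ i, ∑ j, (frameCoeff (ι x) i (ι x) a * frameCoeff (ι x) j (ι x) b) •
          cov (frame (ι x) i) (ι x) (frame (ι x) j (ι x)) := by
      refine Finset.sum_congr rfl fun i _ ↦ ?_
      conv_lhs => rw [← sum_frameCoeff_smul_frame (mem_chart_source E' (ι x)) b]
      simp only [map_sum, map_smul, Finset.smul_sum, smul_smul]
    rw [hexp, hexp, Finset.sum_comm]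
    refine Finset.sum_congr rfl fun i _ ↦ Finset.sum_congr rfl fun j _ ↦ ?_
    rw [hframe, mul_comm]
  have hexpand (v w : E) : covAlong cov ι (fun y ↦ mfderiv 𝓘(ℝ, E) 𝓘(ℝ, E') ι y
      (coordField x v y)) x (coordField x w x) =
      ∑ i, d% (fun y ↦ frameCoeff (ι x) i (ι y)
        (mfderiv 𝓘(ℝ, E) 𝓘(ℝ, E') ι y (coordField x v y))) x (coordField x w x) •
          frame (ι x) i (ι x) +
      ∑ i, frameCoeff (ι x) i (ι x) (mfderiv 𝓘(ℝ, E) 𝓘(ℝ, E') ι x (coordField x v x)) •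
        cov (frame (ι x) i) (ι x) (mfderiv 𝓘(ℝ, E) 𝓘(ℝ, E') ι x (coordField x w x)) := by
    rw [← Finset.sum_add_distrib]
    simp only [covAlong, _root_.sum_apply]
    rfl
  rw [hexpand, hexpand, ← hsecond, add_sub_add_right_eq_sub, sub_eq_zero]
  refine Finset.sum_congr rfl fun i _ ↦ ?_
  rw [hfirst, hfirst, mvfderiv_mvfderiv_coordField_comm (contMDiffAt_coord_comp hι i)]
end AlongRules

/-! ### An immersion reflects differentiability of vector fields. -/

section Gauss
variable {E : Type*} [NormedAddCommGroup E] [NormedSpace ℝ E] [FiniteDimensional ℝ E]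
  {M : Type*} [TopologicalSpace M] [ChartedSpace E M] [IsManifold 𝓘(ℝ, E) ∞ M]
  {E' : Type*} [NormedAddCommGroup E'] [NormedSpace ℝ E'] [FiniteDimensional ℝ E']
  {M' : Type*} [TopologicalSpace M'] [ChartedSpace E' M'] [IsManifold 𝓘(ℝ, E') ∞ M']
  {ι : M → M'} {V W : ∀ x : M, TangentSpace 𝓘(ℝ, E') (ι x)} {x : M}

theorem inTangentCoordinates_mfderiv_apply (y : M) (hy : y ∈ (chartAt E x).source)
    (hy' : ι y ∈ (chartAt E' (ι x)).source) (u : TangentSpace 𝓘(ℝ, E) y) :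
    inTangentCoordinates 𝓘(ℝ, E) 𝓘(ℝ, E') id ι (fun y ↦ mfderiv 𝓘(ℝ, E) 𝓘(ℝ, E') ι y) x y
      (trivializationAt E (TangentSpace 𝓘(ℝ, E) : M → Type _) x ⟨y, u⟩).2 =
    (trivializationAt E' (TangentSpace 𝓘(ℝ, E') : M' → Type _) (ι x)
      ⟨ι y, mfderiv 𝓘(ℝ, E) 𝓘(ℝ, E') ι y u⟩).2 := by
  have h1 := Trivialization.symmL_apply (R := ℝ)
    (trivializationAt E (TangentSpace 𝓘(ℝ, E) : M → Type _) x) hy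
    (trivializationAt E (TangentSpace 𝓘(ℝ, E) : M → Type _) x ⟨y, u⟩).2
  rw [Trivialization.symm_apply_apply_mk
    (trivializationAt E (TangentSpace 𝓘(ℝ, E) : M → Type _) x) hy] at h1
  simp only [inTangentCoordinates, ContinuousLinearMap.inCoordinates,
    ContinuousLinearMap.coe_comp, Function.comp_apply, id]
  rw [h1]
  exact Trivialization.continuousLinearMapAt_apply_of_mem (R := ℝ)
    (trivializationAt E' (TangentSpace 𝓘(ℝ, E') : M' → Type _) (ι x)) hy' _

/-- In coordinates `dι` is a matrix `A y`. With `L` a left inverse of `A x`, the square matrix `L A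
y` is the identity at `x`, hence invertible nearby, and `Z = (L A)⁻¹ L (dι Z)`. The lemma serves the
induced `J_α`, which is defined pointwise by projection with no regularity built in. -/
theorem mdifferentiableAt_of_mfderiv (hι : ContMDiffAt 𝓘(ℝ, E) 𝓘(ℝ, E') ∞ ι x)
    (hinj : Function.Injective (mfderiv 𝓘(ℝ, E) 𝓘(ℝ, E') ι x))
    {Z : ∀ x : M, TangentSpace 𝓘(ℝ, E) x}
    (hZ : MDiffAlongAt E ι (fun y ↦ mfderiv 𝓘(ℝ, E) 𝓘(ℝ, E') ι y (Z y)) x) :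
    MDiffAt (T% Z) x := by
  set A := inTangentCoordinates 𝓘(ℝ, E) 𝓘(ℝ, E') id ι (fun y ↦ mfderiv 𝓘(ℝ, E) 𝓘(ℝ, E') ι y) x
  have hA : MDiffAt A x := (hι.mfderiv_const (m := ∞) (by simp)).mdifferentiableAt (by simp)
  have hZ' := ((mdifferentiableAt_totalSpace _ _).1 hZ).2
  rw [mdifferentiableAt_section]
  have hAinj : Function.Injective (A x) := by
    intro v w hvw
    have hx := FiberBundle.mem_baseSet_trivializationAt' (F := E)
      (E := (TangentSpace 𝓘(ℝ, E) : M → Type _)) x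
    have hx' := FiberBundle.mem_baseSet_trivializationAt' (F := E')
      (E := (TangentSpace 𝓘(ℝ, E') : M' → Type _)) (ι x)
    have hcoord (v : E) := inTangentCoordinates_mfderiv_apply (ι := ι) x (mem_chart_source E x)
      (mem_chart_source E' (ι x))
      ((trivializationAt E (TangentSpace 𝓘(ℝ, E) : M → Type _) x).symm x v)
    simp only [Trivialization.apply_mk_symm _ hx] at hcoord
    have h1 := (hcoord v).symm.trans (hvw.trans (hcoord w))
    have h2 := congrArg ((trivializationAt E' (TangentSpace 𝓘(ℝ, E') : M' → Type _) (ι x)).symm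
      (ι x)) h1
    rw [Trivialization.symm_apply_apply_mk _ hx', Trivialization.symm_apply_apply_mk _ hx'] at h2
    have h3 := Trivialization.apply_mk_symm _ hx v
    rw [hinj h2, Trivialization.apply_mk_symm _ hx w] at h3
    exact (congrArg Prod.snd h3).symm
  obtain ⟨L, hL⟩ := (A x).toLinearMap.exists_leftInverse_of_injective
    (LinearMap.ker_eq_bot.2 hAinj)
  set B : M → E →L[ℝ] E := fun y ↦ L.toContinuousLinearMap ∘L A y
  have hB : MDiffAt B x := mdifferentiableAt_const.clm_comp hA
  have hBx : B x = ContinuousLinearEquiv.refl ℝ E := by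
    ext v
    exact DFunLike.congr_fun hL v
  have hinv : MDiffAt (fun y ↦ (B y).inverse) x := by
    have h1 : DifferentiableAt ℝ (ContinuousLinearMap.inverse : (E →L[ℝ] E) → _) (B x) := by
      rw [hBx]
      exact (contDiffAt_map_inverse (n := 1) _).differentiableAt (by simp)
    exact h1.mdifferentiableAt.comp x hB
  have hfin := hinv.clm_apply
    (L.toContinuousLinearMap.mdifferentiableAt.comp x hZ')
  refine hfin.congr_of_eventuallyEq ?_
  have hunit : ∀ᶠ y in nhds x, (B y).IsInvertible := by
    have := ContinuousLinearEquiv.nhds (ContinuousLinearEquiv.refl ℝ E)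
    rw [← hBx] at this
    exact hB.continuousAt.preimage_mem_nhds this
  filter_upwards [(chartAt E x).open_source.mem_nhds (mem_chart_source E x),
    eventually_mem_source (E' := E') hι.continuousAt, hunit] with y hy hy' hBy
  symm
  refine hBy.inverse_apply_eq.2 ?_
  have := inTangentCoordinates_mfderiv_apply y hy hy' (Z y)
  exact congrArg L this.symm
end Gauss

/-! ### The Gauss formula for the induced Levi-Civita connection. -/

namespace IsHolomorphicSubmanifold
variable {E : Type*} [NormedAddCommGroup E] [NormedSpace ℝ E] [FiniteDimensional ℝ E]
  {M : Type*} [TopologicalSpace M] [ChartedSpace E M] [IsManifold 𝓘(ℝ, E) ∞ M]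
  {E' : Type*} [NormedAddCommGroup E'] [NormedSpace ℝ E'] [FiniteDimensional ℝ E']
  {M' : Type*} [TopologicalSpace M'] [ChartedSpace E' M'] [IsManifold 𝓘(ℝ, E') ∞ M']
  {S : AlmostHypercomplexHN E' M'} {ι : M → M'} (h : IsHolomorphicSubmanifold (E := E) S ι)
  {x : M} {Y : ∀ x : M, TangentSpace 𝓘(ℝ, E) x}
include h

theorem contMDiffAt : ContMDiffAt 𝓘(ℝ, E) 𝓘(ℝ, E') ∞ ι x := h.immersion.contMDiff x

theorem mdifferentiableAt_J (hY : MDiffAt (T% Y) x) (α : Fin 3) :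
    MDiffAt (T% (fun y ↦ h.J α y (Y y))) x := by
  refine mdifferentiableAt_of_mfderiv h.contMDiffAt
    (Function.LeftInverse.injective (h.tangentialPart_mfderiv x)) ?_
  simp only [h.mfderiv_J]
  exact (mdiffAlongAt_mfderiv h.contMDiffAt hY).endomorphism (S.contMDiff_J α)

theorem metric_tangentialPart (w : TangentSpace 𝓘(ℝ, E') (ι x)) (v : TangentSpace 𝓘(ℝ, E) x) :
    h.metric.val x (h.tangentialPart x w) v =
      S.g.val (ι x) w (mfderiv 𝓘(ℝ, E) 𝓘(ℝ, E') ι x v) :=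
  h.metric.val_sharp x _ v

/-- Koszul's formula determines the induced connection. Its three derivative terms are expanded by
`covAlong_metric` and its three brackets by `covAlong_mfderiv_symm`; everything cancels except twice
the pairing of `∇̄_X Y` with `Z`. -/
theorem leviCivita_metric (hY : MDiffAt (T% Y) x) (u : TangentSpace 𝓘(ℝ, E) x) :
    h.metric.leviCivita Y x u = h.tangentialPart x
      (covAlong S.g.leviCivita ι (fun y ↦ mfderiv 𝓘(ℝ, E) 𝓘(ℝ, E') ι y (Y y)) x u) := by
  refine DFunLike.congr_fun (h.metric.leviCivitaFun_ext (A :=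
    LinearMap.toContinuousLinearMap (h.tangentialPart x) ∘L
      covAlong S.g.leviCivita ι (fun y ↦ mfderiv 𝓘(ℝ, E) 𝓘(ℝ, E') ι y (Y y)) x) hY ?_) u
  intro X Z hX hZ
  have hg := S.g.isLeviCivita_leviCivita
  have dX := mdiffAlongAt_mfderiv h.contMDiffAt hX
  have dY := mdiffAlongAt_mfderiv h.contMDiffAt hY
  have dZ := mdiffAlongAt_mfderiv h.contMDiffAt hZ
  have h1 := covAlong_metric hg dY dZ (X x)
  have h2 := covAlong_metric hg dX dZ (Y x)
  have h3 := covAlong_metric hg dX dY (Z x)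
  have t1 := covAlong_mfderiv_symm hg h.contMDiffAt hX hY
  have t2 := covAlong_mfderiv_symm hg h.contMDiffAt hX hZ
  have t3 := covAlong_mfderiv_symm hg h.contMDiffAt hY hZ
  change _ = h.metric.val x (h.tangentialPart x
    (covAlong S.g.leviCivita ι (fun y ↦ mfderiv 𝓘(ℝ, E) 𝓘(ℝ, E') ι y (Y y)) x (X x))) (Z x)
  rw [h.metric_tangentialPart]
  simp only [PseudoRiemannianMetric.koszul, h.metric_val]
  rw [h1, h2, h3, ← t1, ← t2, ← t3]
  simp only [map_sub, _root_.sub_apply]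
  simp only [S.g.symm _ (mfderiv 𝓘(ℝ, E) 𝓘(ℝ, E') ι x _)]
  ring
end IsHolomorphicSubmanifold

/-! ### Pointwise quaternionic algebra that determines the second fundamental form. -/

theorem eq_smul_of_quaternionic {T N : Type*} [AddCommGroup N] [Module ℝ N]
    {g : T → T → ℝ} {B : T → T → N} {J : Fin 3 → T → T} {J' : Fin 3 → N →ₗ[ℝ] N} {k : Fin 3 → N}
    (hg : ∀ u v, g u v = g v u) (hB : ∀ u v, B u v = B v u)
    (hJ' : ∀ α w, J' α (J' α w) = -w) (hJ : ∀ u, J 0 u = J 1 (J 2 u))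
    (hermitian : ∀ u v, g (J 0 u) (J 0 v) = g u v)
    (norden : ∀ α, α ≠ 0 → ∀ u v, g (J α u) (J α v) = -g u v)
    (hBJ : ∀ α u v, B u (J α v) = J' α (B u v) + g u v • k α + g u (J α v) • J' α (k α))
    (α : Fin 3) (u v : T) : B u v = g u v • J' α (k α) := by
  -- `hBJ` is applied in each slot, with the symmetry of `B` in between; the two terms in `g (J α u)
  -- v • k α` cancel, since `J' α` squares to `-1`.
  have hJJ (α u v) : B (J α u) (J α v) = -B u v + (g u v + g (J α u) (J α v)) • J' α (k α) := by
    rw [hBJ, hB (J α u), hBJ α v u, hB v u, hg v u, hg v (J α u)]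
    simp only [map_add, map_smul, hJ']
    module
  have hJJ_norden (α) (hα : α ≠ 0) (u v) : B (J α u) (J α v) = -B u v := by
    rw [hJJ, norden α hα, add_neg_cancel, zero_smul, add_zero]
  have h0 (u v) : B u v = g u v • J' 0 (k 0) := by
    have h1 := hJJ 0 u v
    -- The two Norden sign changes cancel, so `B` is invariant under `J 0 = J 1 ∘ J 2`, while `hJJ
    -- 0` carries the factor `2 g u v`.
    rw [hermitian, hJ, hJ, hJJ_norden 1 (by decide), hJJ_norden 2 (by decide), neg_neg] at h1
    have h2 : (2 : ℝ) • B u v = (2 : ℝ) • (g u v • J' 0 (k 0)) := by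
      linear_combination (norm := module) h1
    exact smul_right_injective N (two_ne_zero (α := ℝ)) h2
  by_cases hg0 : g u v = 0
  · rw [h0, hg0, zero_smul, zero_smul]
  -- `w` measures the disagreement of the two formulas. `hBJ` gives `g u (J α v) • w = g u v • J' α
  -- w`; eliminating `J' α w` between this and its image under `J' α` leaves a sum of squares times
  -- `w`, positive as `g u v ≠ 0`.
  set w := J' 0 (k 0) - J' α (k α) with hw
  have h1 := hBJ α u v
  rw [h0, h0] at h1
  have h2 : g u (J α v) • w = g u v • J' α w := by
    simp only [hw, map_sub, hJ', smul_sub, h1, map_smul]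
    module
  have h3 : (-g u v) • w = g u (J α v) • J' α w := by
    have := congrArg (J' α) h2
    simp only [map_smul, hJ'] at this
    rw [this]
    module
  have h4 : (g u v ^ 2 + g u (J α v) ^ 2) • w = 0 := by
    linear_combination (norm := module) g u (J α v) • h2 - g u v • h3
  have h5 : w = 0 := (smul_eq_zero.1 h4).resolve_left (by positivity)
  rw [h0, ← sub_eq_zero.1 h5]

/-! ### The covariant derivatives of the ambient structures in vector form. -/

namespace AlmostHypercomplexHN
variable {E : Type*} [NormedAddCommGroup E] [NormedSpace ℝ E] [FiniteDimensional ℝ E]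
  {M : Type*} [TopologicalSpace M] [ChartedSpace E M] [IsManifold 𝓘(ℝ, E) ∞ M]
  (S : AlmostHypercomplexHN E M)

theorem val_leeVector (α : Fin 3) (x : M) (w : TangentSpace 𝓘(ℝ, E) x) :
    S.g.val x (S.leeVector α x) w = S.leeForm α x w :=
  S.g.val_sharp x _ w

theorem val_J_zero (x : M) (u v : TangentSpace 𝓘(ℝ, E) x) :
    S.g.val x (S.J 0 x u) v = -S.g.val x u (S.J 0 x v) := by
  have := S.hermitian x u (S.J 0 x v)
  rw [S.J_sq, map_neg] at this
  linarith

theorem val_J_ne_zero {α : Fin 3} (hα : α ≠ 0) (x : M) (u v : TangentSpace 𝓘(ℝ, E) x) :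
    S.g.val x (S.J α x u) v = S.g.val x u (S.J α x v) := by
  have := S.norden α hα x u (S.J α x v)
  rw [S.J_sq, map_neg] at this
  linarith

/-- The value of the sign is irrelevant for commuting `J_α` with the projections, so the Hermitian
and Norden cases are treated at once. -/
theorem exists_val_J (α : Fin 3) : ∃ ε : ℝ, ∀ (x : M) (u v : TangentSpace 𝓘(ℝ, E) x),
    S.g.val x (S.J α x u) v = ε * S.g.val x u (S.J α x v) := by
  by_cases hα : α = 0
  · subst hα
    exact ⟨-1, fun x u v ↦ by rw [S.val_J_zero]; ring⟩
  · exact ⟨1, fun x u v ↦ by rw [S.val_J_ne_zero hα]; ring⟩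

variable {S} {n : ℕ} (hS : S.IsW n)
include hS

/-- Raises the index `w` in `F_zero`. Moving `J₁` off `w` costs a sign, which is why the last two
signs differ from those in `F_zero`. -/
theorem IsW.covDerivEnd_zero (x : M) (u v : TangentSpace 𝓘(ℝ, E) x) :
    covDerivEnd S.g.leviCivita (S.J 0) (FiberBundle.extend E v) x u =
      (1 / (2 * (2 * (n : ℝ) - 1))) •
        (S.g.val x u v • S.leeVector 0 x - S.leeForm 0 x v • u
          + S.g.val x u (S.J 0 x v) • S.J 0 x (S.leeVector 0 x)
          - S.leeForm 0 x (S.J 0 x v) • S.J 0 x u) := by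
  refine S.g.ext_val fun w ↦ (hS.F_zero x u v w).trans ?_
  simp only [map_smul, map_add, map_sub, _root_.smul_apply, _root_.add_apply, _root_.sub_apply,
    smul_eq_mul, S.val_J_zero, S.val_leeVector]
  ring

theorem IsW.covDerivEnd_ne_zero {α : Fin 3} (hα : α ≠ 0) (x : M) (u v : TangentSpace 𝓘(ℝ, E) x) :
    covDerivEnd S.g.leviCivita (S.J α) (FiberBundle.extend E v) x u =
      (1 / (4 * (n : ℝ))) •
        (S.g.val x u v • S.leeVector α x + S.leeForm α x v • u
          + S.g.val x u (S.J α x v) • S.J α x (S.leeVector α x)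
          + S.leeForm α x (S.J α x v) • S.J α x u) := by
  refine S.g.ext_val fun w ↦ (hS.F_ne_zero α hα x u v w).trans ?_
  simp only [map_smul, map_add, _root_.smul_apply, _root_.add_apply,
    smul_eq_mul, S.val_J_ne_zero hα, S.val_leeVector]
  ring
end AlmostHypercomplexHN

/-! ### Tangential and normal parts of the basic identity. -/

namespace IsHolomorphicSubmanifold
variable {E : Type*} [NormedAddCommGroup E] [NormedSpace ℝ E] [FiniteDimensional ℝ E]
  {M : Type*} [TopologicalSpace M] [ChartedSpace E M] [IsManifold 𝓘(ℝ, E) ∞ M]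
  {E' : Type*} [NormedAddCommGroup E'] [NormedSpace ℝ E'] [FiniteDimensional ℝ E']
  {M' : Type*} [TopologicalSpace M'] [ChartedSpace E' M'] [IsManifold 𝓘(ℝ, E') ∞ M']
  {S : AlmostHypercomplexHN E' M'} {ι : M → M'} (h : IsHolomorphicSubmanifold (E := E) S ι)
  {x : M}

/-- Tested against a tangent vector, `J_α` moves to the other side of `g` up to a factor `ε`, the
same for the ambient and the induced metric. -/
theorem tangentialPart_J (α : Fin 3) (w : TangentSpace 𝓘(ℝ, E') (ι x)) :
    h.tangentialPart x (S.J α (ι x) w) = h.J α x (h.tangentialPart x w) := by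
  obtain ⟨ε, hε⟩ := S.exists_val_J α
  refine h.metric.ext_val fun v ↦ ?_
  have h1 := h.metric_tangentialPart w (h.J α x v)
  rw [h.metric_val, h.mfderiv_J] at h1
  rw [h.metric_tangentialPart, h.metric_val, h.mfderiv_J, hε, hε, h1]

theorem normalPart_J (α : Fin 3) (w : TangentSpace 𝓘(ℝ, E') (ι x)) :
    h.normalPart x (S.J α (ι x) w) = S.J α (ι x) (h.normalPart x w) := by
  simp only [normalPart, LinearMap.sub_apply, LinearMap.id_apply, LinearMap.comp_apply,
    h.tangentialPart_J, map_sub]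
  congr 1
  exact h.mfderiv_J α x _

theorem normalPart_mfderiv (u : TangentSpace 𝓘(ℝ, E) x) :
    h.normalPart x (mfderiv 𝓘(ℝ, E) 𝓘(ℝ, E') ι x u) = 0 := by
  have := h.tangentialPart_add_normalPart x (mfderiv 𝓘(ℝ, E) 𝓘(ℝ, E') ι x u)
  rwa [h.tangentialPart_mfderiv, add_eq_left] at this

theorem secondFundamentalForm_symm {X Y : ∀ x : M, TangentSpace 𝓘(ℝ, E) x}
    (hX : MDiffAt (T% X) x) (hY : MDiffAt (T% Y) x) :
    h.secondFundamentalForm x (X x) Y = h.secondFundamentalForm x (Y x) X := by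
  rw [← sub_eq_zero, secondFundamentalForm, secondFundamentalForm, ← map_sub,
    covAlong_mfderiv_symm S.g.isLeviCivita_leviCivita h.contMDiffAt hX hY, h.normalPart_mfderiv]

/-- By symmetry `Y` can be made the direction of differentiation, where only its value at `x`
enters. -/
theorem secondFundamentalForm_eq_extend {Y : ∀ x : M, TangentSpace 𝓘(ℝ, E) x}
    (hY : MDiffAt (T% Y) x) (u : TangentSpace 𝓘(ℝ, E) x) :
    h.secondFundamentalForm x u Y = h.secondFundamentalForm x u (FiberBundle.extend E (Y x)) := by
  have hu := FiberBundle.mdifferentiableAt_extend 𝓘(ℝ, E) E u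
  have h1 := h.secondFundamentalForm_symm hu hY
  have h2 := h.secondFundamentalForm_symm hu
    (FiberBundle.mdifferentiableAt_extend 𝓘(ℝ, E) E (Y x))
  simp only [FiberBundle.extend_apply_self] at h1 h2
  rw [h1, h2]

theorem secondFundamentalForm_J {Y : ∀ x : M, TangentSpace 𝓘(ℝ, E) x}
    (hY : MDiffAt (T% Y) x) (u : TangentSpace 𝓘(ℝ, E) x) (α : Fin 3) :
    h.secondFundamentalForm x u (fun y ↦ h.J α y (Y y)) =
      S.J α (ι x) (h.secondFundamentalForm x u Y) + h.normalPart x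
        (covDerivEnd S.g.leviCivita (S.J α)
          (FiberBundle.extend E' (mfderiv 𝓘(ℝ, E) 𝓘(ℝ, E') ι x (Y x))) (ι x)
            (mfderiv 𝓘(ℝ, E) 𝓘(ℝ, E') ι x u)) := by
  simp only [secondFundamentalForm, h.mfderiv_J]
  rw [covAlong_endomorphism S.g.leviCivita (S.contMDiff_J α)
    (mdiffAlongAt_mfderiv h.contMDiffAt hY), map_add, h.normalPart_J]

theorem covDerivEnd_J {Y : ∀ x : M, TangentSpace 𝓘(ℝ, E) x}
    (hY : MDiffAt (T% Y) x) (u : TangentSpace 𝓘(ℝ, E) x) (α : Fin 3) :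
    covDerivEnd h.metric.leviCivita (h.J α) Y x u = h.tangentialPart x
      (covDerivEnd S.g.leviCivita (S.J α)
        (FiberBundle.extend E' (mfderiv 𝓘(ℝ, E) 𝓘(ℝ, E') ι x (Y x))) (ι x)
          (mfderiv 𝓘(ℝ, E) 𝓘(ℝ, E') ι x u)) := by
  rw [covDerivEnd, _root_.sub_apply, ContinuousLinearMap.comp_apply, h.leviCivita_metric hY,
    h.leviCivita_metric (h.mdifferentiableAt_J hY α)]
  simp only [h.mfderiv_J]
  rw [covAlong_endomorphism S.g.leviCivita (S.contMDiff_J α)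
    (mdiffAlongAt_mfderiv h.contMDiffAt hY), map_add, h.tangentialPart_J, add_sub_cancel_left]

theorem secondFundamentalForm_eq {n : ℕ} (hS : S.IsW n) {Y : ∀ x : M, TangentSpace 𝓘(ℝ, E) x}
    (hY : MDiffAt (T% Y) x) (u : TangentSpace 𝓘(ℝ, E) x) (α : Fin 3) :
    h.secondFundamentalForm x u Y = h.metric.val x u (Y x) • S.J α (ι x)
      ((if α = 0 then 1 / (2 * (2 * (n : ℝ) - 1)) else 1 / (4 * (n : ℝ))) •
        h.normalPart x (S.leeVector α (ι x))) := by
  have hex (v : TangentSpace 𝓘(ℝ, E) x) := FiberBundle.mdifferentiableAt_extend 𝓘(ℝ, E) E v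
  rw [h.secondFundamentalForm_eq_extend hY]
  refine eq_smul_of_quaternionic (g := fun u v ↦ h.metric.val x u v)
    (B := fun u v ↦ h.secondFundamentalForm x u (FiberBundle.extend E v))
    (J := fun α ↦ h.J α x) (J' := fun α ↦ (S.J α (ι x)).toLinearMap)
    (k := fun α ↦ (if α = 0 then 1 / (2 * (2 * (n : ℝ) - 1)) else 1 / (4 * (n : ℝ))) •
        h.normalPart x (S.leeVector α (ι x)))
    (h.metric.symm x) (fun u v ↦ ?_) (fun α w ↦ S.J_sq α (ι x) w) (fun u ↦ ?_) (fun u v ↦ ?_)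
    (fun α hα u v ↦ ?_) (fun α u v ↦ ?_) α u (Y x)
  · have := h.secondFundamentalForm_symm (hex u) (hex v)
    simpa using this
  · refine Function.LeftInverse.injective (h.tangentialPart_mfderiv x) ?_
    simp only [h.mfderiv_J]
    exact S.J_cyclic 0 _ _
  · simp only [h.metric_val, h.mfderiv_J, S.hermitian]
  · simp only [h.metric_val, h.mfderiv_J, S.norden α hα]
  · have h1 := h.secondFundamentalForm_J (hex v) u α
    -- `B` is defined on vectors through their canonical extensions, so the field `J_α` applied to
    -- an extension is replaced by the extension of its value.
    have h2 := h.secondFundamentalForm_eq_extend (h.mdifferentiableAt_J (hex v) α) u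
    rw [h2] at h1
    simp only [FiberBundle.extend_apply_self] at h1
    refine h1.trans ?_
    rw [add_assoc]
    refine congrArg₂ _ rfl ?_
    simp only [h.metric_val, h.mfderiv_J]
    by_cases hα : α = 0
    · subst hα
      rw [hS.covDerivEnd_zero]
      -- The terms along `u` and `J_α u` are tangent and drop out; only those in `p_α` and `J_α p_α`
      -- survive the projection.
      simp only [map_smul, map_add, map_sub, ← h.mfderiv_J, h.normalPart_mfderiv, h.normalPart_J,
        if_true, ContinuousLinearMap.coe_coe]
      module
    · rw [hS.covDerivEnd_ne_zero hα]
      simp only [map_smul, map_add, map_sub, ← h.mfderiv_J, h.normalPart_mfderiv, h.normalPart_J,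
        if_neg hα, ContinuousLinearMap.coe_coe]
      module

theorem IsNormalField.val_mfderiv {N : ∀ x : M, TangentSpace 𝓘(ℝ, E') (ι x)}
    (hN : h.IsNormalField N) (u : TangentSpace 𝓘(ℝ, E) x) :
    S.g.val (ι x) (mfderiv 𝓘(ℝ, E) 𝓘(ℝ, E') ι x u) (N x) = 0 := by
  rw [S.g.symm, hN]

theorem IsNormalField.val_mfderiv_J {N : ∀ x : M, TangentSpace 𝓘(ℝ, E') (ι x)}
    (hN : h.IsNormalField N) (u : TangentSpace 𝓘(ℝ, E) x) (α : Fin 3) :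
    S.g.val (ι x) (mfderiv 𝓘(ℝ, E) 𝓘(ℝ, E') ι x u) (S.J α (ι x) (N x)) = 0 := by
  obtain ⟨ε, hε⟩ := S.exists_val_J α
  rw [S.g.symm, hε, ← h.mfderiv_J, hN, mul_zero]

/-- Both `N` and `J₁ N` are orthogonal to `dι u`, so the terms in `p₁` vanish and the rest is
tangent. It therefore corrects the shape operator and leaves `D` untouched. -/
theorem covDerivEnd_zero_normal {n : ℕ} (hS : S.IsW n) {N : ∀ x : M, TangentSpace 𝓘(ℝ, E') (ι x)}
    (hN : h.IsNormalField N) (u : TangentSpace 𝓘(ℝ, E) x) :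
    covDerivEnd S.g.leviCivita (S.J 0) (FiberBundle.extend E' (N x)) (ι x)
      (mfderiv 𝓘(ℝ, E) 𝓘(ℝ, E') ι x u) = mfderiv 𝓘(ℝ, E) 𝓘(ℝ, E') ι x
        (-(1 / (2 * (2 * (n : ℝ) - 1))) • (S.leeForm 0 (ι x) (N x) • u
          + S.leeForm 0 (ι x) (S.J 0 (ι x) (N x)) • h.J 0 x u)) := by
  rw [hS.covDerivEnd_zero, hN.val_mfderiv, hN.val_mfderiv_J]
  simp only [map_smul, map_add, h.mfderiv_J]
  module

theorem covDerivEnd_ne_zero_normal {n : ℕ} (hS : S.IsW n)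
    {N : ∀ x : M, TangentSpace 𝓘(ℝ, E') (ι x)} (hN : h.IsNormalField N)
    (u : TangentSpace 𝓘(ℝ, E) x) {α : Fin 3} (hα : α ≠ 0) :
    covDerivEnd S.g.leviCivita (S.J α) (FiberBundle.extend E' (N x)) (ι x)
      (mfderiv 𝓘(ℝ, E) 𝓘(ℝ, E') ι x u) = mfderiv 𝓘(ℝ, E) 𝓘(ℝ, E') ι x
        ((1 / (4 * (n : ℝ))) • (S.leeForm α (ι x) (N x) • u
          + S.leeForm α (ι x) (S.J α (ι x) (N x)) • h.J α x u)) := by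
  rw [hS.covDerivEnd_ne_zero hα, hN.val_mfderiv, hN.val_mfderiv_J]
  simp only [map_smul, map_add, h.mfderiv_J]
  module
end IsHolomorphicSubmanifold

/-! ### Assembly of the structural formulas. -/

theorem mainTheorem1
    {E : Type*} [NormedAddCommGroup E] [NormedSpace ℝ E] [FiniteDimensional ℝ E]
    {M : Type*} [TopologicalSpace M] [ChartedSpace E M] [IsManifold 𝓘(ℝ, E) ∞ M]
    {E' : Type*} [NormedAddCommGroup E'] [NormedSpace ℝ E'] [FiniteDimensional ℝ E']
    {M' : Type*} [TopologicalSpace M'] [ChartedSpace E' M'] [IsManifold 𝓘(ℝ, E') ∞ M']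
    (m n : ℕ) (hm : finrank ℝ E = 4 * m) (hn : finrank ℝ E' = 4 * n) (hmn : m < n)
    (S : AlmostHypercomplexHN E' M') (hS : S.IsW n)
    (ι : M → M') (h : IsHolomorphicSubmanifold (E := E) S ι) :
    -- the second fundamental form
    (∀ (x : M) (u : TangentSpace 𝓘(ℝ, E) x) (Y : ∀ x : M, TangentSpace 𝓘(ℝ, E) x),
      CMDiffAt ∞ (T% Y) x →
      h.secondFundamentalForm x u Y = (1 / (2 * (2 * (n : ℝ) - 1)) * h.metric.val x u (Y x)) •
          S.J 0 (ι x) (h.normalPart x (S.leeVector 0 (ι x))) ∧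
      ∀ α : Fin 3, α ≠ 0 →
        h.secondFundamentalForm x u Y = (1 / (4 * (n : ℝ)) * h.metric.val x u (Y x)) •
          S.J α (ι x) (h.normalPart x (S.leeVector α (ι x)))) ∧
    -- the covariant derivatives of the restrictions of the almost complex structures
    (∀ (x : M) (u : TangentSpace 𝓘(ℝ, E) x) (Y : ∀ x : M, TangentSpace 𝓘(ℝ, E) x),
      CMDiffAt ∞ (T% Y) x →
      covDerivEnd h.metric.leviCivita (h.J 0) Y x u = (1 / (2 * (2 * (n : ℝ) - 1))) •
        (h.metric.val x u (Y x) • h.tangentialPart x (S.leeVector 0 (ι x))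
          - S.leeForm 0 (ι x) (mfderiv 𝓘(ℝ, E) 𝓘(ℝ, E') ι x (Y x)) • u
          + h.metric.val x u (h.J 0 x (Y x)) •
              h.J 0 x (h.tangentialPart x (S.leeVector 0 (ι x)))
          - S.leeForm 0 (ι x) (mfderiv 𝓘(ℝ, E) 𝓘(ℝ, E') ι x (h.J 0 x (Y x))) • h.J 0 x u) ∧
      ∀ α : Fin 3, α ≠ 0 →
        covDerivEnd h.metric.leviCivita (h.J α) Y x u = (1 / (4 * (n : ℝ))) •
          (h.metric.val x u (Y x) • h.tangentialPart x (S.leeVector α (ι x))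
            + S.leeForm α (ι x) (mfderiv 𝓘(ℝ, E) 𝓘(ℝ, E') ι x (Y x)) • u
            + h.metric.val x u (h.J α x (Y x)) •
                h.J α x (h.tangentialPart x (S.leeVector α (ι x)))
            + S.leeForm α (ι x) (mfderiv 𝓘(ℝ, E) 𝓘(ℝ, E') ι x (h.J α x (Y x))) • h.J α x u)) ∧
    -- the shape operators and the normal connection
    (∀ (N : ∀ x : M, TangentSpace 𝓘(ℝ, E') (ι x)), h.IsNormalField N →
      ∀ (x : M) (u : TangentSpace 𝓘(ℝ, E) x),
      ContMDiffAt 𝓘(ℝ, E) 𝓘(ℝ, E').tangent ∞ (fun y ↦ (⟨ι y, N y⟩ : TangentBundle 𝓘(ℝ, E') M')) x →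
      h.shapeOperator (fun y ↦ S.J 0 (ι y) (N y)) x u =
        h.J 0 x (h.shapeOperator N x u) + (1 / (2 * (2 * (n : ℝ) - 1))) •
          (S.leeForm 0 (ι x) (N x) • u + S.leeForm 0 (ι x) (S.J 0 (ι x) (N x)) • h.J 0 x u) ∧
      (∀ α : Fin 3, α ≠ 0 →
        h.shapeOperator (fun y ↦ S.J α (ι y) (N y)) x u =
          h.J α x (h.shapeOperator N x u) - (1 / (4 * (n : ℝ))) •
            (S.leeForm α (ι x) (N x) • u + S.leeForm α (ι x) (S.J α (ι x) (N x)) • h.J α x u)) ∧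
      ∀ α : Fin 3, h.normalConnection x u (fun y ↦ S.J α (ι y) (N y)) =
        S.J α (ι x) (h.normalConnection x u N)) := by
  refine ⟨fun x u Y hY ↦ ?_, fun x u Y hY ↦ ?_, fun N hN x u hNx ↦ ?_⟩
  · have hY' := hY.mdifferentiableAt (by simp)
    refine ⟨?_, fun α hα ↦ ?_⟩
    · rw [h.secondFundamentalForm_eq hS hY' u 0, if_pos rfl, map_smul]
      module
    · rw [h.secondFundamentalForm_eq hS hY' u α, if_neg hα, map_smul]
      module
  · have hY' := hY.mdifferentiableAt (by simp)
    refine ⟨?_, fun α hα ↦ ?_⟩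
    · rw [h.covDerivEnd_J hY', hS.covDerivEnd_zero]
      simp only [map_smul, map_add, map_sub, h.tangentialPart_J, h.tangentialPart_mfderiv,
        h.metric_val, h.mfderiv_J]
    · rw [h.covDerivEnd_J hY', hS.covDerivEnd_ne_zero hα]
      simp only [map_smul, map_add, map_sub, h.tangentialPart_J, h.tangentialPart_mfderiv,
        h.metric_val, h.mfderiv_J]
  · have hNx' : MDiffAlongAt E ι N x := hNx.mdifferentiableAt (by simp)
    refine ⟨?_, fun α hα ↦ ?_, fun α ↦ ?_⟩
    · rw [IsHolomorphicSubmanifold.shapeOperator, IsHolomorphicSubmanifold.shapeOperator,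
        covAlong_endomorphism S.g.leviCivita (S.contMDiff_J _) hNx',
        h.covDerivEnd_zero_normal hS hN, map_add, h.tangentialPart_J,
        h.tangentialPart_mfderiv, map_neg]
      module
    · rw [IsHolomorphicSubmanifold.shapeOperator, IsHolomorphicSubmanifold.shapeOperator,
        covAlong_endomorphism S.g.leviCivita (S.contMDiff_J _) hNx',
        h.covDerivEnd_ne_zero_normal hS hN u hα, map_add,
        h.tangentialPart_J, h.tangentialPart_mfderiv, map_neg]
      module
    · rw [IsHolomorphicSubmanifold.normalConnection, IsHolomorphicSubmanifold.normalConnection,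
        covAlong_endomorphism S.g.leviCivita (S.contMDiff_J _) hNx', map_add, h.normalPart_J]
      by_cases hα : α = 0
      · subst hα
        rw [h.covDerivEnd_zero_normal hS hN, h.normalPart_mfderiv, add_zero]
      · rw [h.covDerivEnd_ne_zero_normal hS hN u hα, h.normalPart_mfderiv, add_zero]
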